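/- Let $d\in\{1,2,3\}$ and let $\Omega\subset\mathbb R^d$ be a bounded domain (an interval if $d=1$, polygonal if $d=2$, polyhedral if $d=3$). Let $\nu>0$, $y_d\in L^2(\Omega)$, $u_d\in L^\infty(\Omega)$, and $a(y,v)=\int_\Omega\nabla y\cdot\nabla v\,dx$ for $y,v\in H_0^1(\Omega)$. Write $(\cdot,\cdot)$ for the inner product of $L^2(\Omega)$ and $$J(y,u)=\tfrac12\|y-y_d\|_{L^2(\Omega)}^2+\tfrac\nu2\|u-u_d\|_{L^2(\Omega)}^2 .$$ For a closed subspace $V\subset H_0^1(\Omega)$ and $u\in L^2(\Omega)$ let $S_V(u)\in V$ be the unique $y\in V$ with $$a(y,v-y)+\|v\|_{L^1(\Omega)}-\|y\|_{L^1(\Omega)}\ \ge\ (u,v-y)\qquad\text{for all } v\in V .$$ Put $f(u)=J(S_{H_0^1(\Omega)}(u),u)$ for $u\in L^2(\Omega)$. Let $\{\mathcal T_h\}$ be a family of conforming simplicial meshes of $\Omega$ with mesh widths $h=\max_{T\in\mathcal T_h}\operatorname{diam}T\to0$: each $\mathcal T_h$ is a finite set of simplices whose closures have union $\bar\Omega$,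 and the closures of any two of them intersect in the convex hull of their common vertices. Assume that the family is shape-regular and quasi-uniform, i.e. there is $\rho>0$, independent of $h$, such that every $T\in\mathcal T_h$ contains a ball of radius $\rho\operatorname{diam}T$ and a ball of radius $\rho h$. Let $V_h$ be the space of all $v\in H_0^1(\Omega)$ such that $v|_T$ is a polynomial of degree at most one for every $T\in\mathcal T_h$, and put $f_h(u)=J(S_{V_h}(u),u)$ for $u\in L^2(\Omega)$. Problem $(P_h)$ is the minimization of $f_h$ over $L^2(\Omega)$, and a local solution of $(P_h)$ is a local minimizer of $f_h$ with respect to the $L^2(\Omega)$-norm. Let $\bar u\in L^2(\Omega)$ satisfy the quadratic growth condition: there are $\varepsilon,\delta>0$ such that $$f(\bar u)\le f(u)-\delta\|u-\bar u\|_{L^2(\Omega)}^2\qquad\text{for all } u\in B_\varepsilon(\bar u):=\{u\in L^2(\Omega):\|u-\bar u\|_{L^2(\Omega)}\le\varepsilon\}.$$ Then for every mesh of the family the localized problem $$\min_{u\in B_\varepsilon(\bar u)} f_h(u)$$ has a global minimizer, and there are local solutions $\bar u_h$ of $(P_h)$, one for every mesh of the family, such that $\bar u_h\to\bar u$ in $L^2(\Omega)$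 as $h\to0$ and, for all sufficiently small $h$, $\bar u_h$ is a global minimizer of the localized problem. -/

import Mathlib

open MeasureTheory Filter Topology Set
open scoped ContDiff RealInnerProductSpace

noncomputable section

namespace VIControl

/-- `ℝ^d` with its Euclidean norm. -/
abbrev Eucl (d : ℕ) : Type := EuclideanSpace ℝ (Fin d)

/-- The real Hilbert space `L²(Ω)`. -/
abbrev L2 {d : ℕ} (Ω : Set (Eucl d)) : Type := Lp ℝ 2 (volume.restrict Ω)

/-- The real Hilbert space `L²(Ω; ℝ^d)`. -/
abbrev L2Vec {d : ℕ} (Ω : Set (Eucl d)) : Type := Lp (Eucl d) 2 (volume.restrict Ω)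

/-- Pairs `(y, g)` with `y ∈ L²(Ω)` and `g ∈ L²(Ω; ℝ^d)`, with the Hilbert norm
`(‖y‖² + ‖g‖²)^{1/2}`; on pairs `(y, ∇y)` this is the norm of `H¹(Ω)`. -/
abbrev GradPair {d : ℕ} (Ω : Set (Eucl d)) : Type := WithLp 2 (L2 Ω × L2Vec Ω)

/-- The pairs `(φ, ∇φ)` for `φ ∈ C_c^∞(Ω)`. -/
def testPairs {d : ℕ} (Ω : Set (Eucl d)) : Submodule ℝ (GradPair Ω) where
  carrier := {p | ∃ φ : Eucl d → ℝ, ContDiff ℝ ∞ φ ∧ HasCompactSupport φ ∧ tsupport φ ⊆ Ω ∧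
    p.fst =ᵐ[volume.restrict Ω] φ ∧ p.snd =ᵐ[volume.restrict Ω] gradient φ}
  zero_mem' := by
    refine ⟨0, contDiff_const, HasCompactSupport.zero, by simp [tsupport], ?_, ?_⟩
    · exact Lp.coeFn_zero _ _ _
    · refine (Lp.coeFn_zero _ _ _).trans (Eventually.of_forall fun x => ?_)
      simp [gradient]
  add_mem' := by
    rintro p q ⟨φ, h1, h2, h3, h4, h5⟩ ⟨ψ, k1, k2, k3, k4, k5⟩
    refine ⟨φ + ψ, h1.add k1, h2.add k2,
      (tsupport_add φ ψ).trans (union_subset h3 k3), ?_, ?_⟩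
    · exact (Lp.coeFn_add p.fst q.fst).trans (h4.add k4)
    · refine (Lp.coeFn_add p.snd q.snd).trans ((h5.add k5).trans (Eventually.of_forall fun x => ?_))
      have e1 : DifferentiableAt ℝ φ x := (h1.differentiable (by simp)) x
      have e2 : DifferentiableAt ℝ ψ x := (k1.differentiable (by simp)) x
      simp [gradient, fderiv_add e1 e2]
  smul_mem' := by
    rintro c p ⟨φ, h1, h2, h3, h4, h5⟩
    refine ⟨c • φ, contDiff_const.smul h1, h2.smul_left (f := fun _ => c),
      (closure_mono (Function.support_const_smul_subset c φ)).trans h3, ?_, ?_⟩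
    · exact (Lp.coeFn_smul c p.fst).trans (h4.const_smul c)
    · refine (Lp.coeFn_smul c p.snd).trans ((h5.const_smul c).trans
        (Eventually.of_forall fun x => ?_))
      have e1 : DifferentiableAt ℝ φ x := (h1.differentiable (by simp)) x
      simp [gradient, fderiv_const_smul e1]

/-- `H₀¹(Ω)`: the closure of `C_c^∞(Ω)` in the norm of `H¹(Ω)`. Its elements are written as pairs
`(y, ∇y)` of a function and its weak gradient, as subspace of `L²(Ω) × L²(Ω; ℝ^d)`. -/
def H10 {d : ℕ} (Ω : Set (Eucl d)) : Submodule ℝ (GradPair Ω) :=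
  (testPairs Ω).topologicalClosure

/-- The bilinear form `a(y, v) = (∇y, ∇v)_{L²(Ω)}`. -/
def bilin {d : ℕ} {Ω : Set (Eucl d)} (y v : GradPair Ω) : ℝ := ⟪y.snd, v.snd⟫

/-- The norm of `L¹(Ω)` of the function `v`. -/
def normL1 {d : ℕ} {Ω : Set (Eucl d)} (v : GradPair Ω) : ℝ := ∫ x in Ω, |v.fst x|

/-- `y ∈ V` solves the variational inequality of the second kind on the subspace `V`:
`a(y, v - y) + ‖v‖_{L¹} - ‖y‖_{L¹} ≥ (u, v - y)` for all `v ∈ V`. -/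
def SolvesVI {d : ℕ} {Ω : Set (Eucl d)} (V : Submodule ℝ (GradPair Ω)) (u : L2 Ω)
    (y : GradPair Ω) : Prop :=
  y ∈ V ∧ ∀ v ∈ V, ⟪u, (v - y).fst⟫ ≤ bilin y (v - y) + normL1 v - normL1 y

open scoped Classical in
/-- The control-to-state operator on `V`: the solution of the variational inequality for `u`
(for `V = H₀¹(Ω)` and its closed subspaces it exists and is unique if `Ω` is bounded, `d ≥ 1`). -/
def solOp {d : ℕ} {Ω : Set (Eucl d)} (V : Submodule ℝ (GradPair Ω)) (u : L2 Ω) : GradPair Ω :=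
  if h : ∃ y, SolvesVI V u y then h.choose else 0

/-- The objective `J(y, u) = ½ ‖y - y_d‖² + (ν / 2) ‖u - u_d‖²`, with norms of `L²(Ω)`. -/
def cost {d : ℕ} {Ω : Set (Eucl d)} (ν : ℝ) (yd ud : L2 Ω) (y : GradPair Ω) (u : L2 Ω) : ℝ :=
  1 / 2 * ‖y.fst - yd‖ ^ 2 + ν / 2 * ‖u - ud‖ ^ 2

/-- The reduced objective `u ↦ J(S_V(u), u)`. -/
def reduced {d : ℕ} {Ω : Set (Eucl d)} (V : Submodule ℝ (GradPair Ω)) (ν : ℝ) (yd ud : L2 Ω)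
    (u : L2 Ω) : ℝ :=
  cost ν yd ud (solOp V u) u

/-- A simplicial mesh of `Ω`. A simplex is given by the set of its `d + 1` vertices; the closed
simplices cover `closure Ω` exactly, and two of them meet at most in a common face. -/
structure Mesh {d : ℕ} (Ω : Set (Eucl d)) where
  elements : Finset (Finset (Eucl d))
  card_eq : ∀ s ∈ elements, s.card = d + 1
  affineIndependent : ∀ s ∈ elements, AffineIndependent ℝ ((↑) : s → Eucl d)
  covers : closure Ω = ⋃ s ∈ elements, convexHull ℝ (s : Set (Eucl d))
  conforming : ∀ s ∈ elements, ∀ t ∈ elements,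
    convexHull ℝ (s : Set (Eucl d)) ∩ convexHull ℝ (t : Set (Eucl d)) ⊆
      convexHull ℝ ((s : Set (Eucl d)) ∩ (t : Set (Eucl d)))

/-- The diameter `h_T` of the simplex with vertex set `s`. -/
def simplexDiam {d : ℕ} (s : Finset (Eucl d)) : ℝ := Metric.diam (convexHull ℝ (s : Set (Eucl d)))

/-- The mesh width `h = max_T h_T`. -/
def Mesh.width {d : ℕ} {Ω : Set (Eucl d)} (T : Mesh Ω) : ℝ :=
  sSup (simplexDiam '' (T.elements : Set (Finset (Eucl d))))

/-- A family of meshes is shape-regular: every simplex `T` contains a ball of radius `ρ h_T`,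
with `ρ > 0` independent of `T` and of the mesh. -/
def ShapeRegular {d : ℕ} {Ω : Set (Eucl d)} {ι : Type*} (T : ι → Mesh Ω) : Prop :=
  ∃ ρ > 0, ∀ i, ∀ s ∈ (T i).elements, ∃ x : Eucl d,
    Metric.closedBall x (ρ * simplexDiam s) ⊆ convexHull ℝ (s : Set (Eucl d))

/-- A family of meshes is quasi-uniform: every simplex of a mesh of width `h` contains a ball of
radius `ρ h`, with `ρ > 0` independent of the simplex and of the mesh. -/
def QuasiUniform {d : ℕ} {Ω : Set (Eucl d)} {ι : Type*} (T : ι → Mesh Ω) : Prop :=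
  ∃ ρ > 0, ∀ i, ∀ s ∈ (T i).elements, ∃ x : Eucl d,
    Metric.closedBall x (ρ * (T i).width) ⊆ convexHull ℝ (s : Set (Eucl d))

/-- The finite element space `V_h`: the functions in `H₀¹(Ω)` that coincide almost everywhere on
each simplex of the mesh with a polynomial of degree at most one. -/
def Mesh.space {d : ℕ} {Ω : Set (Eucl d)} (T : Mesh Ω) : Submodule ℝ (GradPair Ω) where
  carrier := {v | v ∈ H10 Ω ∧ ∀ s ∈ T.elements, ∃ g : Eucl d →ᵃ[ℝ] ℝ,
    ∀ᵐ x ∂(volume.restrict Ω), x ∈ convexHull ℝ (s : Set (Eucl d)) → v.fst x = g x}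
  zero_mem' := by
    refine ⟨zero_mem _, fun s _ => ⟨0, ?_⟩⟩
    filter_upwards [Lp.coeFn_zero ℝ 2 (volume.restrict Ω)] with x hx _
    exact hx
  add_mem' := by
    rintro p q ⟨hp, hp'⟩ ⟨hq, hq'⟩
    refine ⟨add_mem hp hq, fun s hs => ?_⟩
    obtain ⟨g, hg⟩ := hp' s hs
    obtain ⟨k, hk⟩ := hq' s hs
    refine ⟨g + k, ?_⟩
    filter_upwards [hg, hk, Lp.coeFn_add p.fst q.fst] with x h1 h2 h3 hx
    have : (p + q).fst x = p.fst x + q.fst x := h3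
    rw [this, h1 hx, h2 hx]
    rfl
  smul_mem' := by
    rintro c p ⟨hp, hp'⟩
    refine ⟨Submodule.smul_mem _ c hp, fun s hs => ?_⟩
    obtain ⟨g, hg⟩ := hp' s hs
    refine ⟨c • g, ?_⟩
    filter_upwards [hg, Lp.coeFn_smul c p.fst] with x h1 h3 hx
    have : (c • p).fst x = c • p.fst x := h3
    rw [this, h1 hx]
    rfl

/-- Quadratic growth of `F` at `ubar` with radius `ε` and constant `δ`. -/
def QuadraticGrowth {d : ℕ} {Ω : Set (Eucl d)} (F : L2 Ω → ℝ) (ubar : L2 Ω) (ε δ : ℝ) : Prop :=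
  ∀ u ∈ Metric.closedBall ubar ε, F ubar ≤ F u - δ * ‖u - ubar‖ ^ 2

/-- `u` is a global minimizer of `F` over the closed ball of radius `ε` around `ubar`. -/
def SolvesLocalized {d : ℕ} {Ω : Set (Eucl d)} (F : L2 Ω → ℝ) (ubar : L2 Ω) (ε : ℝ)
    (u : L2 Ω) : Prop :=
  u ∈ Metric.closedBall ubar ε ∧ IsMinOn F (Metric.closedBall ubar ε) u

end VIControl

end

open VIControl

/-!
The difference of two solutions of the variational inequality for the controls `u` and `u'` is
bounded in the energy norm by the pairing of `u - u'` with it, so by Poincaré's inequality the map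
`u ↦ (S_V u).fst` is Lipschitz continuous, with a constant that does not depend on `V ≤ H₀¹(Ω)`.
For fixed `u`, solutions minimize a strongly convex energy, hence Galerkin solutions converge as
soon as the spaces become dense. By Rellich's theorem the control-to-state maps factor up to a small
error through one finite-dimensional space of controls, so this convergence is uniform on bounded
sets, and with it the convergence of the reduced objectives. Quadratic growth then forces
minimizers over `B_ε(ubar)` to converge to `ubar`; once they are interior points, they are local
minimizers.

The finite element spaces become dense because nodal interpolation of a test function converges in
`H¹`: on a simplex of diameter `δ` that contains a ball of radius `ρ δ`, the interpolant and the
Taylor polynomial of degree one differ by `O(δ²)`, hence their gradients by `O(δ / ρ)`.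
-/

noncomputable section

namespace VIControl

open scoped NNReal ENNReal

section StrongConvexity

variable {E : Type*} [NormedAddCommGroup E]

lemma exists_isMinOn_of_strongConvexOn [NormedSpace ℝ E] [CompleteSpace E] {s : Set E} {m : ℝ}
    {f : E → ℝ} (hf : StrongConvexOn s m f) (hm : 0 < m) (hcont : ContinuousOn f s)
    (hs : IsClosed s) (hne : s.Nonempty) (hbdd : BddBelow (f '' s)) : ∃ x ∈ s, IsMinOn f s x := by
  obtain ⟨r, hanti, hlim, hr⟩ := exists_seq_tendsto_sInf (hne.image f) hbdd
  choose x hxs hxr using hr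
  have hinf_le : ∀ y ∈ s, sInf (f '' s) ≤ f y := fun y hy => csInf_le hbdd (mem_image_of_mem f hy)
  have hdist : ∀ n k, n ≤ k → ‖x n - x k‖ ^ 2 ≤ 8 / m * (r n - sInf (f '' s)) := by
    intro n k hnk
    have hmid := hf.2 (hxs n) (hxs k) (by norm_num : (0 : ℝ) ≤ 1 / 2)
      (by norm_num : (0 : ℝ) ≤ 1 / 2) (by norm_num)
    have hmem := hf.1 (hxs n) (hxs k) (by norm_num : (0 : ℝ) ≤ 1 / 2)
      (by norm_num : (0 : ℝ) ≤ 1 / 2) (by norm_num)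
    have hle := hinf_le _ hmem
    have hrk := hanti hnk
    simp only [smul_eq_mul, hxr] at hmid
    rw [div_mul_eq_mul_div, le_div_iff₀ hm]
    linarith
  have hcauchy : CauchySeq x := by
    refine cauchySeq_of_le_tendsto_0' (fun n => √(8 / m * (r n - sInf (f '' s))))
      (fun n k hnk => (dist_eq_norm _ _).trans_le (Real.le_sqrt_of_sq_le (hdist n k hnk))) ?_
    simpa using ((hlim.sub_const (sInf (f '' s))).const_mul (8 / m)).sqrt
  obtain ⟨y, hy⟩ := cauchySeq_tendsto_of_complete hcauchy
  have hys : y ∈ s := hs.mem_of_tendsto hy (Eventually.of_forall hxs)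
  have hfy : Tendsto (fun n => f (x n)) atTop (𝓝 (f y)) :=
    (hcont y hys).tendsto.comp (tendsto_nhdsWithin_iff.2 ⟨hy, Eventually.of_forall hxs⟩)
  simp only [hxr] at hfy
  exact ⟨y, hys, fun v hv => (tendsto_nhds_unique hfy hlim).trans_le (hinf_le v hv)⟩

lemma norm_smul_add_smul_sq [InnerProductSpace ℝ E] (x y : E) {a b : ℝ} (hab : a + b = 1) :
    ‖a • x + b • y‖ ^ 2 = a * ‖x‖ ^ 2 + b * ‖y‖ ^ 2 - a * b * ‖x - y‖ ^ 2 := by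
  obtain rfl : b = 1 - a := by linarith
  rw [norm_add_sq_real, norm_sub_sq_real, norm_smul, norm_smul, real_inner_smul_left,
    real_inner_smul_right, mul_pow, mul_pow, Real.norm_eq_abs, Real.norm_eq_abs, sq_abs, sq_abs]
  ring

end StrongConvexity

section VariationalInequality

variable {d : ℕ} {Ω : Set (Eucl d)} {V W : Submodule ℝ (GradPair Ω)} {u w : L2 Ω}
  {y z v : GradPair Ω} {C : ℝ≥0}

lemma normL1_nonneg (v : GradPair Ω) : 0 ≤ normL1 v :=
  integral_nonneg fun _ => abs_nonneg _

@[simp]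
lemma normL1_eq_inner [IsFiniteMeasure (volume.restrict Ω)] (v : GradPair Ω) :
    normL1 v = ⟪Lp.const 2 (volume.restrict Ω) (1 : ℝ), |v.fst|⟫ := by
  rw [L2.inner_def]
  refine integral_congr_ae ?_
  filter_upwards [Lp.coeFn_const (p := 2) (μ := volume.restrict Ω) (1 : ℝ),
    Lp.coeFn_abs v.fst] with x hone habs
  rw [hone, habs]
  simp

lemma continuous_normL1 [IsFiniteMeasure (volume.restrict Ω)] :
    Continuous (normL1 : GradPair Ω → ℝ) := by
  have hfst : Continuous fun v : GradPair Ω => v.fst := WithLp.continuous_fst 2 _ _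
  exact (continuous_const.inner (hfst.sup hfst.neg)).congr fun v => (normL1_eq_inner v).symm

lemma convexOn_normL1 [IsFiniteMeasure (volume.restrict Ω)] :
    ConvexOn ℝ univ (normL1 : GradPair Ω → ℝ) := by
  refine ⟨convex_univ, fun v _ w _ a b ha hb _ => ?_⟩
  have hint (v : GradPair Ω) : Integrable (fun x => |v.fst x|) (volume.restrict Ω) :=
    ((Lp.memLp v.fst).integrable (by norm_num)).abs
  simp only [normL1, smul_eq_mul, ← integral_const_mul]
  rw [← integral_add ((hint v).const_mul a) ((hint w).const_mul b)]
  refine integral_mono_ae (hint _) (((hint v).const_mul a).add ((hint w).const_mul b)) ?_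
  filter_upwards [Lp.coeFn_add (a • v.fst) (b • w.fst), Lp.coeFn_smul a v.fst,
    Lp.coeFn_smul b w.fst] with x hadd hv hw
  calc |(a • v.fst + b • w.fst) x| = |a * v.fst x + b * w.fst x| := by
        rw [hadd, Pi.add_apply, hv, hw]; rfl
    _ ≤ |a * v.fst x| + |b * w.fst x| := abs_add_le _ _
    _ = a * |v.fst x| + b * |w.fst x| := by
        rw [abs_mul, abs_mul, abs_of_nonneg ha, abs_of_nonneg hb]

/-- The Poincaré inequality `‖y‖ ≤ C ‖∇y‖` on a space `V` of pairs `(y, ∇y)`. -/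
def HasPoincare (V : Submodule ℝ (GradPair Ω)) (C : ℝ≥0) : Prop :=
  ∀ v ∈ V, ‖v.fst‖ ≤ C * ‖v.snd‖

lemma HasPoincare.mono (hV : HasPoincare V C) (hWV : W ≤ V) : HasPoincare W C :=
  fun v hv => hV v (hWV hv)

lemma HasPoincare.norm_sq_le (hV : HasPoincare V C) (hv : v ∈ V) :
    ‖v‖ ^ 2 ≤ (C ^ 2 + 1) * ‖v.snd‖ ^ 2 := by
  have hsq := pow_le_pow_left₀ (norm_nonneg _) (hV v hv) 2
  rw [WithLp.prod_norm_sq_eq_of_L2]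
  linarith

/-- The energy `½ a(y, y) + ‖y‖_{L¹} - (u, y)`, whose minimizers on `V` are the solutions of the
variational inequality. -/
def energy (u : L2 Ω) (y : GradPair Ω) : ℝ :=
  1 / 2 * ‖y.snd‖ ^ 2 + normL1 y - ⟪u, y.fst⟫

lemma continuous_energy [IsFiniteMeasure (volume.restrict Ω)] (u : L2 Ω) :
    Continuous (energy u) :=
  ((continuous_const.mul ((WithLp.continuous_snd 2 _ _).norm.pow 2)).add continuous_normL1).sub
    (continuous_const.inner (WithLp.continuous_fst 2 _ _))

lemma HasPoincare.le_energy (hV : HasPoincare V C) (u : L2 Ω) (hv : v ∈ V) :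
    -(1 / 2 * (C * ‖u‖) ^ 2) ≤ energy u v := by
  have hinner : ⟪u, v.fst⟫ ≤ ‖u‖ * (C * ‖v.snd‖) :=
    (real_inner_le_norm u v.fst).trans (mul_le_mul_of_nonneg_left (hV v hv) (norm_nonneg u))
  have hL1 := normL1_nonneg v
  unfold energy
  nlinarith [sq_nonneg (‖v.snd‖ - C * ‖u‖)]

lemma HasPoincare.strongConvexOn_energy [IsFiniteMeasure (volume.restrict Ω)]
    (hV : HasPoincare V C) (u : L2 Ω) :
    StrongConvexOn (V : Set (GradPair Ω)) (1 / (C ^ 2 + 1)) (energy u) := by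
  refine ⟨V.convex, fun v hv w hw a b ha hb hab => ?_⟩
  have hL1 := convexOn_normL1.2 (mem_univ v) (mem_univ w) ha hb hab
  have hinner : ⟪u, (a • v + b • w).fst⟫ = a * ⟪u, v.fst⟫ + b * ⟪u, w.fst⟫ := by
    rw [WithLp.add_fst, WithLp.smul_fst, WithLp.smul_fst, inner_add_right,
      real_inner_smul_right, real_inner_smul_right]
  have hsnd : ‖(a • v + b • w).snd‖ ^ 2
      = a * ‖v.snd‖ ^ 2 + b * ‖w.snd‖ ^ 2 - a * b * ‖(v - w).snd‖ ^ 2 :=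
    norm_smul_add_smul_sq v.snd w.snd hab
  have hnorm : 1 / (C ^ 2 + 1) * ‖v - w‖ ^ 2 ≤ ‖(v - w).snd‖ ^ 2 := by
    rw [one_div, inv_mul_le_iff₀ (by positivity)]
    exact hV.norm_sq_le (V.sub_mem hv hw)
  have hab_nonneg := mul_le_mul_of_nonneg_left hnorm (mul_nonneg ha hb)
  simp only [energy, smul_eq_mul] at hL1 ⊢
  rw [hinner, hsnd]
  linarith

lemma norm_snd_sq_eq_add_bilin (v y : GradPair Ω) :
    ‖v.snd‖ ^ 2 = ‖y.snd‖ ^ 2 + 2 * bilin y (v - y) + ‖(v - y).snd‖ ^ 2 := by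
  conv_lhs => rw [← add_sub_cancel y v, WithLp.add_snd, norm_add_sq_real]
  rfl

lemma SolvesVI.energy_gap (hy : SolvesVI V u y) (hv : v ∈ V) :
    1 / 2 * ‖(v - y).snd‖ ^ 2 ≤ energy u v - energy u y := by
  have hVI := hy.2 v hv
  have hsq := norm_snd_sq_eq_add_bilin v y
  rw [WithLp.sub_fst, inner_sub_right] at hVI
  unfold energy
  linarith

lemma solvesVI_of_isMinOn [IsFiniteMeasure (volume.restrict Ω)] (hyV : y ∈ V)
    (hy : IsMinOn (energy u) V y) : SolvesVI V u y := by
  refine ⟨hyV, fun v hv => ?_⟩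
  set A := bilin y (v - y) + normL1 v - normL1 y - ⟪u, (v - y).fst⟫ with hA
  -- Compare the energies of `y` and `y + t (v - y)` and let `t` tend to `0`.
  have hsegment : ∀ t ∈ Ioc (0 : ℝ) 1, 0 ≤ A + t * (1 / 2 * ‖(v - y).snd‖ ^ 2) := by
    rintro t ⟨ht, ht1⟩
    set z := (1 - t) • y + t • v with hz
    have hzy : z - y = t • (v - y) := by rw [hz]; module
    have hmin : energy u y ≤ energy u z := hy (V.add_mem (V.smul_mem _ hyV) (V.smul_mem _ hv))
    have hsq := norm_snd_sq_eq_add_bilin z y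
    have hbilin : bilin y (z - y) = t * bilin y (v - y) := by
      rw [hzy]; exact real_inner_smul_right _ _ _
    have hnorm : ‖(z - y).snd‖ ^ 2 = t ^ 2 * ‖(v - y).snd‖ ^ 2 := by
      rw [hzy, WithLp.smul_snd, norm_smul, mul_pow, Real.norm_eq_abs, sq_abs]
    have hinner : ⟪u, z.fst⟫ - ⟪u, y.fst⟫ = t * ⟪u, (v - y).fst⟫ := by
      rw [← inner_sub_right, ← real_inner_smul_right, ← WithLp.sub_fst, hzy, WithLp.smul_fst]
    have hL1 := convexOn_normL1.2 (mem_univ y) (mem_univ v) (sub_nonneg.2 ht1) ht.le (by ring)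
    simp only [energy, smul_eq_mul, ← hz] at hmin hL1
    refine nonneg_of_mul_nonneg_right (?_ : 0 ≤ t * _) ht
    rw [hA]
    nlinarith
  have hlim : Tendsto (fun t : ℝ => A + t * (1 / 2 * ‖(v - y).snd‖ ^ 2)) (𝓝[>] 0) (𝓝 A) :=
    tendsto_nhdsWithin_of_tendsto_nhds (Continuous.tendsto' (by fun_prop) _ _ (by ring))
  have hA_nonneg : 0 ≤ A :=
    ge_of_tendsto hlim (by filter_upwards [Ioc_mem_nhdsGT one_pos] using hsegment)
  linarith

lemma HasPoincare.solvesVI_solOp [IsFiniteMeasure (volume.restrict Ω)] (hP : HasPoincare V C)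
    (hV : IsClosed (V : Set (GradPair Ω))) (u : L2 Ω) : SolvesVI V u (solOp V u) := by
  obtain ⟨y, hyV, hy⟩ := exists_isMinOn_of_strongConvexOn (hP.strongConvexOn_energy u)
    (by positivity) (continuous_energy u).continuousOn hV ⟨0, V.zero_mem⟩
    ⟨_, forall_mem_image.2 fun _ hv => hP.le_energy u hv⟩
  have hex : ∃ y, SolvesVI V u y := ⟨y, solvesVI_of_isMinOn hyV hy⟩
  rw [solOp, dif_pos hex]
  exact hex.choose_spec

lemma SolvesVI.norm_snd_sub_sq_le_inner (hy : SolvesVI V u y) (hz : SolvesVI V w z) :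
    ‖(y - z).snd‖ ^ 2 ≤ ⟪u - w, (y - z).fst⟫ := by
  have hVIy := hy.2 z hz.1
  have hVIz := hz.2 y hy.1
  have hbilin : bilin y (z - y) + bilin z (y - z) = -‖(y - z).snd‖ ^ 2 := by
    simp only [bilin, WithLp.sub_snd, ← real_inner_self_eq_norm_sq, inner_sub_left,
      inner_sub_right, real_inner_comm y.snd z.snd]
    ring
  simp only [WithLp.sub_fst, inner_sub_left, inner_sub_right] at hVIy hVIz ⊢
  linarith

lemma SolvesVI.norm_snd_sub_le (hy : SolvesVI V u y) (hz : SolvesVI V w z) {κ : ℝ} (hκ : 0 ≤ κ)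
    (h : ∀ v ∈ V, ⟪u - w, v.fst⟫ ≤ κ * ‖v.snd‖) : ‖(y - z).snd‖ ≤ κ := by
  have hsq := (hy.norm_snd_sub_sq_le_inner hz).trans (h _ (V.sub_mem hy.1 hz.1))
  by_contra! hlt
  nlinarith [norm_nonneg (y - z).snd]

lemma SolvesVI.norm_snd_sub_sq_le_energy (hWV : W ≤ V) (hy : SolvesVI V u y)
    (hz : SolvesVI W u z) (hv : v ∈ W) :
    ‖(z - y).snd‖ ^ 2 ≤ 2 * (energy u v - energy u y) := by
  have hgap := hy.energy_gap (hWV hz.1)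
  have hmin := hz.energy_gap hv
  nlinarith [sq_nonneg ‖(v - z).snd‖]

end VariationalInequality

section UniformConvergence

variable {ι α β : Type*} {l : Filter ι} {s : Set α}

lemma tendstoUniformlyOn_of_lipschitzWith [PseudoMetricSpace α] [PseudoMetricSpace β]
    {F : ι → α → β} {f : α → β} {K : ℝ≥0} (hs : TotallyBounded s)
    (hF : ∀ i, LipschitzWith K (F i)) (hf : LipschitzWith K f)
    (h : ∀ x, Tendsto (F · x) l (𝓝 (f x))) : TendstoUniformlyOn F f l s := by
  refine Metric.tendstoUniformlyOn_iff.2 fun η hη => ?_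
  obtain ⟨t, ht, hst⟩ := Metric.totallyBounded_iff.1 hs (η / (4 * (K + 1))) (by positivity)
  have hcenters : ∀ᶠ i in l, ∀ x ∈ t, dist (F i x) (f x) < η / 2 :=
    (eventually_all_finite ht).2 fun x _ => Metric.tendsto_nhds.1 (h x) _ (half_pos hη)
  filter_upwards [hcenters] with i hi y hy
  obtain ⟨x, hxt, hxy⟩ := mem_iUnion₂.1 (hst hy)
  have hK : K * dist y x ≤ η / 4 := by
    have := (mul_lt_mul_of_pos_left (Metric.mem_ball.1 hxy) (by positivity : (0 : ℝ) < K + 1)).le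
    rw [show (K + 1 : ℝ) * (η / (4 * (K + 1))) = η / 4 by field_simp] at this
    linarith [dist_nonneg (x := y) (y := x)]
  have hFi := (hF i).dist_le_mul x y
  have hfi := hf.dist_le_mul y x
  rw [dist_comm x y] at hFi
  calc dist (f y) (F i y) ≤ dist (f y) (f x) + dist (f x) (F i x) + dist (F i x) (F i y) :=
        dist_triangle4 _ _ _ _
    _ < η := by linarith [hi x hxt, dist_comm (F i x) (f x)]

lemma tendstoUniformlyOn_norm_sq [SeminormedAddCommGroup β] {F : ι → α → β} {f : α → β} {M : ℝ}
    (h : TendstoUniformlyOn F f l s) (hf : ∀ x ∈ s, ‖f x‖ ≤ M) :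
    TendstoUniformlyOn (fun i x => ‖F i x‖ ^ 2) (fun x => ‖f x‖ ^ 2) l s := by
  refine Metric.tendstoUniformlyOn_iff.2 fun η hη => ?_
  have hpos : 0 < min 1 (η / (2 * |M| + 1)) := by positivity
  filter_upwards [Metric.tendstoUniformlyOn_iff.1 h _ hpos] with i hi x hx
  have hclose := hi x hx
  rw [dist_eq_norm] at hclose
  have hsub : |‖f x‖ - ‖F i x‖| ≤ ‖f x - F i x‖ := abs_norm_sub_norm_le _ _
  have hsum : ‖f x‖ + ‖F i x‖ ≤ 2 * |M| + 1 := by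
    linarith [hf x hx, le_abs_self M, neg_le_of_abs_le hsub, hclose.trans_le (min_le_left _ _)]
  calc dist (‖f x‖ ^ 2) (‖F i x‖ ^ 2) = |‖f x‖ - ‖F i x‖| * (‖f x‖ + ‖F i x‖) := by
        rw [Real.dist_eq, ← abs_of_nonneg (by positivity : 0 ≤ ‖f x‖ + ‖F i x‖), ← abs_mul]
        ring_nf
    _ ≤ ‖f x - F i x‖ * (2 * |M| + 1) := by gcongr
    _ < η := (lt_div_iff₀ (by positivity)).1 (hclose.trans_le (min_le_right _ _))

end UniformConvergence

section ReducedProblem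

variable {d : ℕ} {Ω : Set (Eucl d)} {V : Submodule ℝ (GradPair Ω)} {C : ℝ≥0}

lemma le_reduced (ν : ℝ) (yd ud u : L2 Ω) : ν / 2 * ‖u - ud‖ ^ 2 ≤ reduced V ν yd ud u :=
  le_add_of_nonneg_left (by positivity)

lemma exists_finiteDimensional_mem_of_map (V : Submodule ℝ (GradPair Ω))
    [FiniteDimensional ℝ (V.map (WithLp.fstL 2 ℝ (L2 Ω) (L2Vec Ω)).toLinearMap)]
    {s : Set (L2 Ω)} (hs : s.Finite) :
    ∃ X : Submodule ℝ (L2 Ω), FiniteDimensional ℝ X ∧ (∀ v ∈ V, v.fst ∈ X) ∧ s ⊆ X := by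
  have := FiniteDimensional.span_of_finite ℝ hs
  exact ⟨V.map (WithLp.fstL 2 ℝ (L2 Ω) (L2Vec Ω)).toLinearMap ⊔ Submodule.span ℝ s, inferInstance,
    fun v hv => Submodule.mem_sup_left (Submodule.mem_map_of_mem hv),
    fun x hx => Submodule.mem_sup_right (Submodule.subset_span hx)⟩

variable [IsFiniteMeasure (volume.restrict Ω)]

lemma HasPoincare.norm_solOp_fst_sub_le (hP : HasPoincare V C)
    (hV : IsClosed (V : Set (GradPair Ω))) {u w : L2 Ω} {κ : ℝ} (hκ : 0 ≤ κ)
    (h : ∀ v ∈ V, ⟪u - w, v.fst⟫ ≤ κ * ‖v.snd‖) :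
    ‖(solOp V u).fst - (solOp V w).fst‖ ≤ C * κ := by
  have hu := hP.solvesVI_solOp hV u
  have hw := hP.solvesVI_solOp hV w
  exact (hP _ (V.sub_mem hu.1 hw.1)).trans
    (mul_le_mul_of_nonneg_left (hu.norm_snd_sub_le hw hκ h) C.coe_nonneg)

lemma HasPoincare.lipschitzWith_solOp_fst (hP : HasPoincare V C)
    (hV : IsClosed (V : Set (GradPair Ω))) :
    LipschitzWith (C * C) fun u => (solOp V u).fst := by
  refine LipschitzWith.of_dist_le_mul fun u w => ?_
  rw [dist_eq_norm, dist_eq_norm, NNReal.coe_mul, mul_assoc]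
  refine hP.norm_solOp_fst_sub_le hV (by positivity) fun v hv => ?_
  calc ⟪u - w, v.fst⟫ ≤ ‖u - w‖ * ‖v.fst‖ := real_inner_le_norm _ _
    _ ≤ ‖u - w‖ * (C * ‖v.snd‖) := mul_le_mul_of_nonneg_left (hP v hv) (norm_nonneg _)
    _ = C * ‖u - w‖ * ‖v.snd‖ := by ring

lemma HasPoincare.continuous_reduced (hP : HasPoincare V C)
    (hV : IsClosed (V : Set (GradPair Ω))) (ν : ℝ) (yd ud : L2 Ω) :
    Continuous (reduced V ν yd ud) := by
  have hstate := (hP.lipschitzWith_solOp_fst hV).continuous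
  unfold reduced cost
  fun_prop

lemma HasPoincare.norm_solOp_fst_sub_starProjection_le (hP : HasPoincare V C)
    (hV : IsClosed (V : Set (GradPair Ω))) {X : Submodule ℝ (L2 Ω)} [FiniteDimensional ℝ X]
    {τ : ℝ≥0} (hX : ∀ v ∈ V, ∃ x ∈ X, ‖v.fst - x‖ ≤ τ * ‖v.snd‖) (u : L2 Ω) :
    ‖(solOp V u).fst - (solOp V (X.starProjection u)).fst‖ ≤ C * (τ * ‖u‖) := by
  refine hP.norm_solOp_fst_sub_le hV (by positivity) fun v hv => ?_
  obtain ⟨x, hxX, hx⟩ := hX v hv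
  have horth : ⟪u - X.starProjection u, x⟫ = 0 :=
    Submodule.inner_left_of_mem_orthogonal hxX (Submodule.sub_starProjection_mem_orthogonal u)
  have hnorm : ‖u - X.starProjection u‖ ≤ ‖u‖ := by
    simpa [Submodule.starProjection_orthogonal] using Submodule.norm_starProjection_apply_le Xᗮ u
  calc ⟪u - X.starProjection u, v.fst⟫ = ⟪u - X.starProjection u, v.fst - x⟫ := by
        rw [inner_sub_right, horth, sub_zero]
    _ ≤ ‖u - X.starProjection u‖ * ‖v.fst - x‖ := real_inner_le_norm _ _
    _ ≤ ‖u‖ * (τ * ‖v.snd‖) := mul_le_mul hnorm hx (norm_nonneg _) (norm_nonneg _)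
    _ = τ * ‖u‖ * ‖v.snd‖ := by ring

lemma norm_starProjection_sub_le {E : Type*} [NormedAddCommGroup E] [InnerProductSpace ℝ E]
    (X : Submodule ℝ E) [X.HasOrthogonalProjection] {x : E} (hx : x ∈ X) (u : E) :
    ‖X.starProjection u - x‖ ≤ ‖u - x‖ := by
  simpa [map_sub, Submodule.starProjection_eq_self_iff.2 hx] using
    Submodule.norm_starProjection_apply_le X (u - x)

lemma HasPoincare.reduced_starProjection_le (hP : HasPoincare V C)
    (hV : IsClosed (V : Set (GradPair Ω))) {X : Submodule ℝ (L2 Ω)} [FiniteDimensional ℝ X]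
    (hX : ∀ v ∈ V, v.fst ∈ X) {ν : ℝ} (hν : 0 ≤ ν) (yd : L2 Ω) {ud : L2 Ω} (hud : ud ∈ X)
    (u : L2 Ω) : reduced V ν yd ud (X.starProjection u) ≤ reduced V ν yd ud u := by
  have hstate : (solOp V u).fst = (solOp V (X.starProjection u)).fst := by
    simpa [sub_eq_zero] using
      hP.norm_solOp_fst_sub_starProjection_le hV (τ := 0) (fun v hv => ⟨v.fst, hX v hv, by simp⟩) u
  have hcontrol := norm_starProjection_sub_le X hud u
  unfold reduced cost
  rw [hstate]
  gcongr

lemma HasPoincare.exists_solvesLocalized (hP : HasPoincare V C)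
    (hV : IsClosed (V : Set (GradPair Ω)))
    [FiniteDimensional ℝ (V.map (WithLp.fstL 2 ℝ (L2 Ω) (L2Vec Ω)).toLinearMap)]
    {ν : ℝ} (hν : 0 ≤ ν) (yd ud ubar : L2 Ω) {ε : ℝ} (hε : 0 ≤ ε) :
    ∃ u, SolvesLocalized (reduced V ν yd ud) ubar ε u := by
  obtain ⟨X, hXfin, hVX, hsX⟩ := exists_finiteDimensional_mem_of_map V (toFinite {ubar, ud})
  have hub : ubar ∈ X := hsX (by simp)
  have := FiniteDimensional.proper_real X
  obtain ⟨x, hx, hmin⟩ := (isCompact_closedBall (⟨ubar, hub⟩ : X) ε).exists_isMinOn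
    ⟨_, Metric.mem_closedBall_self hε⟩
    ((hP.continuous_reduced hV ν yd ud).comp continuous_subtype_val).continuousOn
  refine ⟨x, hx, fun u hu => ?_⟩
  have hproj : X.orthogonalProjectionOnto u ∈ Metric.closedBall (⟨ubar, hub⟩ : X) ε := by
    rw [mem_closedBall_iff_norm] at hu ⊢
    exact (norm_starProjection_sub_le X hub u).trans hu
  calc reduced V ν yd ud x ≤ reduced V ν yd ud (X.starProjection u) := hmin hproj
    _ ≤ reduced V ν yd ud u := hP.reduced_starProjection_le hV hVX hν yd (hsX (by simp)) u

lemma HasPoincare.exists_forall_reduced_le (hP : HasPoincare V C)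
    (hV : IsClosed (V : Set (GradPair Ω)))
    [FiniteDimensional ℝ (V.map (WithLp.fstL 2 ℝ (L2 Ω) (L2Vec Ω)).toLinearMap)]
    {ν : ℝ} (hν : 0 < ν) (yd ud : L2 Ω) :
    ∃ u, ∀ w, reduced V ν yd ud u ≤ reduced V ν yd ud w := by
  obtain ⟨X, hXfin, hVX, hsX⟩ := exists_finiteDimensional_mem_of_map V (toFinite {ud})
  have hud : ud ∈ X := hsX rfl
  have := FiniteDimensional.proper_real X
  have hcoercive : Tendsto (fun x : X => reduced V ν yd ud x) (cocompact X) atTop := by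
    have hdist := (tendsto_pow_atTop two_ne_zero).comp
      (tendsto_dist_right_cocompact_atTop (⟨ud, hud⟩ : X))
    refine tendsto_atTop_mono (fun x => ?_) (hdist.const_mul_atTop (half_pos hν))
    simpa [Subtype.dist_eq, dist_eq_norm] using le_reduced (V := V) ν yd ud x
  obtain ⟨x, hx⟩ := ((hP.continuous_reduced hV ν yd ud).comp
    continuous_subtype_val).exists_forall_le hcoercive
  exact ⟨x, fun w => (hx (X.orthogonalProjectionOnto w)).trans
    (hP.reduced_starProjection_le hV hVX hν.le yd hud w)⟩

end ReducedProblem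

section Galerkin

variable {d : ℕ} {Ω : Set (Eucl d)} {ι : Type*} {l : Filter ι}
  {V : ι → Submodule ℝ (GradPair Ω)} {W : Submodule ℝ (GradPair Ω)} {C : ℝ≥0}

/-- The embedding `(y, ∇y) ↦ y` of `W` into `L²(Ω)` is compact, in the form: finite-dimensional
subspaces of `L²(Ω)` approximate `y` up to arbitrarily small multiples of `‖∇y‖`. -/
def CompactlyEmbedded (W : Submodule ℝ (GradPair Ω)) : Prop :=
  ∀ τ : ℝ≥0, 0 < τ → ∃ X : Submodule ℝ (L2 Ω), FiniteDimensional ℝ X ∧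
    ∀ v ∈ W, ∃ x ∈ X, ‖v.fst - x‖ ≤ τ * ‖v.snd‖

/-- A conforming Galerkin approximation of `W`: closed subspaces `V i`, the functions in each of
which span a finite-dimensional space, such that every element of `W` is a limit of elements of
the `V i` along `l`. -/
structure IsGalerkin (V : ι → Submodule ℝ (GradPair Ω)) (W : Submodule ℝ (GradPair Ω))
    (l : Filter ι) : Prop where
  le (i : ι) : V i ≤ W
  isClosed (i : ι) : IsClosed (V i : Set (GradPair Ω))
  finiteDimensional (i : ι) :
    FiniteDimensional ℝ ((V i).map (WithLp.fstL 2 ℝ (L2 Ω) (L2Vec Ω)).toLinearMap)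
  tendsto_infDist : ∀ y ∈ W, Tendsto (fun i => Metric.infDist y (V i)) l (𝓝 0)

lemma QuadraticGrowth.tendsto_of_solvesLocalized {F : ι → L2 Ω → ℝ} {f : L2 Ω → ℝ} {ubar : L2 Ω}
    {ε δ : ℝ} (hqg : QuadraticGrowth f ubar ε δ) (hδ : 0 < δ)
    (hF : TendstoUniformlyOn F f l (Metric.closedBall ubar ε)) {u : ι → L2 Ω}
    (hu : ∀ i, SolvesLocalized (F i) ubar ε (u i)) : Tendsto u l (𝓝 ubar) := by
  refine Metric.tendsto_nhds.2 fun η hη => ?_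
  filter_upwards [Metric.tendstoUniformlyOn_iff.1 hF (δ * η ^ 2 / 2) (by positivity)] with i hi
  have hubar : ubar ∈ Metric.closedBall ubar ε :=
    Metric.mem_closedBall_self (dist_nonneg.trans (Metric.mem_closedBall.1 (hu i).1))
  have hclose_u := abs_lt.1 (hi (u i) (hu i).1)
  have hclose_ubar := abs_lt.1 (hi ubar hubar)
  have hlt : δ * ‖u i - ubar‖ ^ 2 < δ * η ^ 2 := by
    linarith [hqg (u i) (hu i).1, isMinOn_iff.1 (hu i).2 ubar hubar]
  rw [dist_eq_norm]
  exact lt_of_pow_lt_pow_left₀ 2 hη.le (lt_of_mul_lt_mul_left hlt hδ.le)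

lemma QuadraticGrowth.exists_isLocalMin_tendsto {F : ι → L2 Ω → ℝ} {f : L2 Ω → ℝ} {ubar : L2 Ω}
    {ε δ : ℝ} (hqg : QuadraticGrowth f ubar ε δ) (hε : 0 < ε) (hδ : 0 < δ)
    (hF : TendstoUniformlyOn F f l (Metric.closedBall ubar ε))
    (hloc : ∀ i, ∃ u, SolvesLocalized (F i) ubar ε u) (hglob : ∀ i, ∃ u, ∀ w, F i u ≤ F i w) :
    ∃ u : ι → L2 Ω, (∀ i, IsLocalMin (F i) (u i)) ∧
      (∀ᶠ i in l, SolvesLocalized (F i) ubar ε (u i)) ∧ Tendsto u l (𝓝 ubar) := by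
  choose v hv using hloc
  choose g hg using hglob
  have hlim := hqg.tendsto_of_solvesLocalized hδ hF hv
  classical
  -- A localized minimizer in the interior of the ball is a local one; for the remaining indices
  -- a global minimizer is taken instead.
  set u : ι → L2 Ω := fun i => if v i ∈ Metric.ball ubar ε then v i else g i with hu
  have heq : ∀ᶠ i in l, v i = u i :=
    (hlim.eventually (Metric.ball_mem_nhds ubar hε)).mono fun i hi => (if_pos hi).symm
  refine ⟨u, fun i => ?_, heq.mono fun i hi => hi ▸ hv i, hlim.congr' heq⟩
  by_cases hi : v i ∈ Metric.ball ubar ε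
  · simpa only [hu, if_pos hi] using (hv i).2.isLocalMin
      (mem_of_superset (Metric.isOpen_ball.mem_nhds hi) Metric.ball_subset_closedBall)
  · have hui : u i = g i := if_neg hi
    rw [hui]
    exact Eventually.of_forall (hg i)

variable [IsFiniteMeasure (volume.restrict Ω)]

lemma IsGalerkin.tendsto_solOp_fst (hV : IsGalerkin V W l) (hW : IsClosed (W : Set (GradPair Ω)))
    (hP : HasPoincare W C) (u : L2 Ω) :
    Tendsto (fun i => (solOp (V i) u).fst) l (𝓝 (solOp W u).fst) := by
  have hy := hP.solvesVI_solOp hW u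
  set y := solOp W u
  refine Metric.tendsto_nhds.2 fun η hη => ?_
  have hpos : 0 < (η / (C + 1)) ^ 2 / 2 := by positivity
  obtain ⟨r, hr, hE⟩ := Metric.continuous_iff.1 (continuous_energy u) y _ hpos
  filter_upwards [(hV.tendsto_infDist y hy.1).eventually_lt_const hr] with i hi
  obtain ⟨v, hv, hvy⟩ := (Metric.infDist_lt_iff (V i).nonempty).1 hi
  have hz := (hP.mono (hV.le i)).solvesVI_solOp (hV.isClosed i) u
  have hquasi := hy.norm_snd_sub_sq_le_energy (hV.le i) hz hv
  have henergy := (abs_lt.1 (hE v (by rwa [dist_comm]))).2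
  have hsnd : ‖(solOp (V i) u - y).snd‖ < η / (C + 1) :=
    lt_of_pow_lt_pow_left₀ 2 (by positivity) (by linarith)
  rw [lt_div_iff₀ (by positivity)] at hsnd
  have hfst := hP _ (W.sub_mem (hV.le i hz.1) hy.1)
  rw [dist_eq_norm, ← WithLp.sub_fst]
  linarith [norm_nonneg (solOp (V i) u - y).snd]

lemma IsGalerkin.tendstoUniformlyOn_solOp_fst (hV : IsGalerkin V W l)
    (hW : IsClosed (W : Set (GradPair Ω))) (hP : HasPoincare W C) (hK : CompactlyEmbedded W)
    {s : Set (L2 Ω)} (hs : Bornology.IsBounded s) :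
    TendstoUniformlyOn (fun i u => (solOp (V i) u).fst) (fun u => (solOp W u).fst) l s := by
  refine Metric.tendstoUniformlyOn_iff.2 fun η hη => ?_
  obtain ⟨R, hR, hsR⟩ := hs.exists_pos_norm_le
  lift R to ℝ≥0 using hR.le
  lift η to ℝ≥0 using hη.le
  replace hR : 0 < R := NNReal.coe_pos.1 hR
  replace hη : 0 < η := NNReal.coe_pos.1 hη
  obtain ⟨X, hXfin, hX⟩ := hK (η / 3 / ((C + 1) * R)) (by positivity)
  have htb : TotallyBounded (X.starProjection '' s) := by
    have := FiniteDimensional.proper_real X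
    have hbdd : Bornology.IsBounded (X.orthogonalProjectionOnto '' s) :=
      X.orthogonalProjectionOnto.lipschitz.isBounded_image hs
    have := (hbdd.isCompact_closure.totallyBounded.subset subset_closure).image
      X.subtypeL.uniformContinuous
    rwa [image_image] at this
  have hconv := Metric.tendstoUniformlyOn_iff.1 (tendstoUniformlyOn_of_lipschitzWith htb
    (fun i => (hP.mono (hV.le i)).lipschitzWith_solOp_fst (hV.isClosed i))
    (hP.lipschitzWith_solOp_fst hW) (hV.tendsto_solOp_fst hW hP)) (η / 3) (by positivity)
  have hproj : ∀ U ≤ W, IsClosed (U : Set (GradPair Ω)) → ∀ u ∈ s,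
      dist (solOp U u).fst (solOp U (X.starProjection u)).fst ≤ η / 3 := by
    intro U hU hUc u hu
    rw [dist_eq_norm]
    calc _ ≤ C * (↑(η / 3 / ((C + 1) * R)) * ‖u‖) :=
          (hP.mono hU).norm_solOp_fst_sub_starProjection_le hUc (fun v hv => hX v (hU hv)) u
      _ ≤ (C + 1) * (↑(η / 3 / ((C + 1) * R)) * R) := by
          gcongr
          exacts [le_add_of_nonneg_right zero_le_one, hsR u hu]
      _ = η / 3 := by push_cast; field_simp
  filter_upwards [hconv] with i hi u hu
  calc dist (solOp W u).fst (solOp (V i) u).fst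
      ≤ _ + dist (solOp W (X.starProjection u)).fst (solOp (V i) (X.starProjection u)).fst + _ :=
        dist_triangle4 _ _ _ _
    _ < η := by
        linarith [hproj W le_rfl hW u hu, hi _ (mem_image_of_mem _ hu),
          dist_comm (solOp (V i) u).fst _ ▸ hproj (V i) (hV.le i) (hV.isClosed i) u hu]

lemma IsGalerkin.tendstoUniformlyOn_reduced (hV : IsGalerkin V W l)
    (hW : IsClosed (W : Set (GradPair Ω))) (hP : HasPoincare W C) (hK : CompactlyEmbedded W)
    (ν : ℝ) (yd ud : L2 Ω) {s : Set (L2 Ω)} (hs : Bornology.IsBounded s) :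
    TendstoUniformlyOn (fun i => reduced (V i) ν yd ud) (reduced W ν yd ud) l s := by
  have hstate := hV.tendstoUniformlyOn_solOp_fst hW hP hK hs
  obtain ⟨M, hM⟩ := ((hP.lipschitzWith_solOp_fst hW).isBounded_image hs).exists_norm_le
  have hsub : TendstoUniformlyOn (fun i u => (solOp (V i) u).fst - yd)
      (fun u => (solOp W u).fst - yd) l s := by
    simpa [Metric.tendstoUniformlyOn_iff] using hstate
  have hsq := tendstoUniformlyOn_norm_sq (M := M + ‖yd‖) hsub fun u hu =>
    (norm_sub_le _ _).trans (by gcongr; exact hM _ (mem_image_of_mem _ hu))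
  refine Metric.tendstoUniformlyOn_iff.2 fun η hη => ?_
  filter_upwards [Metric.tendstoUniformlyOn_iff.1 hsq η hη] with i hi u hu
  have hlt := hi u hu
  rw [Real.dist_eq] at hlt ⊢
  rw [reduced, reduced, cost, cost, add_sub_add_right_eq_sub, ← mul_sub, abs_mul, abs_of_pos]
  · linarith [abs_nonneg (‖(solOp W u).fst - yd‖ ^ 2 - ‖(solOp (V i) u).fst - yd‖ ^ 2)]
  · norm_num

lemma IsGalerkin.exists_isLocalMin_tendsto (hV : IsGalerkin V W l)
    (hW : IsClosed (W : Set (GradPair Ω))) (hP : HasPoincare W C) (hK : CompactlyEmbedded W)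
    {ν : ℝ} (hν : 0 < ν) {yd ud ubar : L2 Ω} {ε δ : ℝ} (hε : 0 < ε) (hδ : 0 < δ)
    (hqg : QuadraticGrowth (reduced W ν yd ud) ubar ε δ) :
    (∀ i, ∃ u : L2 Ω, SolvesLocalized (reduced (V i) ν yd ud) ubar ε u) ∧
    ∃ u : ι → L2 Ω, (∀ i, IsLocalMin (reduced (V i) ν yd ud) (u i)) ∧
      (∀ᶠ i in l, SolvesLocalized (reduced (V i) ν yd ud) ubar ε (u i)) ∧
      Tendsto u l (𝓝 ubar) := by
  have := hV.finiteDimensional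
  have hPV (i : ι) : HasPoincare (V i) C := hP.mono (hV.le i)
  have hloc (i : ι) := (hPV i).exists_solvesLocalized (hV.isClosed i) hν.le yd ud ubar hε.le
  have hglob (i : ι) := (hPV i).exists_forall_reduced_le (hV.isClosed i) hν yd ud
  exact ⟨hloc, hqg.exists_isLocalMin_tendsto hε hδ
    (hV.tendstoUniformlyOn_reduced hW hP hK ν yd ud Metric.isBounded_closedBall) hloc hglob⟩

end Galerkin

section Translation

variable {α E F : Type*} [MeasurableSpace α] [NormedAddCommGroup F]

lemma eLpNorm_two_sq (f : α → F) (μ : Measure α) : eLpNorm f 2 μ ^ 2 = ∫⁻ x, ‖f x‖ₑ ^ 2 ∂μ := by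
  simpa using eLpNorm_nnreal_pow_eq_lintegral (μ := μ) (f := f) (p := 2) two_ne_zero

lemma eLpNorm_two_le_iff {f : α → F} {μ : Measure α} {c : ℝ≥0∞} :
    eLpNorm f 2 μ ≤ c ↔ ∫⁻ x, ‖f x‖ₑ ^ 2 ∂μ ≤ c ^ 2 := by
  rw [← eLpNorm_two_sq, ENNReal.pow_le_pow_left_iff two_ne_zero]

variable [NormedSpace ℝ F]

lemma enorm_integral_sq_le {μ : Measure α} [IsProbabilityMeasure μ] {f : α → F}
    (hf : AEStronglyMeasurable f μ) : ‖∫ x, f x ∂μ‖ₑ ^ 2 ≤ ∫⁻ x, ‖f x‖ₑ ^ 2 ∂μ := by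
  rw [← eLpNorm_two_sq]
  gcongr
  calc ‖∫ x, f x ∂μ‖ₑ ≤ eLpNorm f 1 μ := by
        rw [eLpNorm_one_eq_lintegral_enorm]
        exact enorm_integral_le_lintegral_enorm f
    _ ≤ eLpNorm f 2 μ := eLpNorm_le_eLpNorm_of_exponent_le one_le_two hf

variable [NormedAddCommGroup E] [NormedSpace ℝ E] [CompleteSpace F]

lemma enorm_add_sub_sq_le_lintegral_fderiv {φ : E → F} (hφ : ContDiff ℝ 1 φ) (x z : E) :
    ‖φ (x + z) - φ x‖ₑ ^ 2 ≤
      ‖z‖ₑ ^ 2 * ∫⁻ t in Ioc (0 : ℝ) 1, ‖fderiv ℝ φ (x + t • z)‖ₑ ^ 2 := by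
  have hderiv (t : ℝ) : HasDerivAt (fun t : ℝ => φ (x + t • z)) (fderiv ℝ φ (x + t • z) z) t :=
    (hφ.differentiable one_ne_zero _).hasFDerivAt.comp_hasDerivAt t
      (by simpa using ((hasDerivAt_id t).smul_const z).const_add x)
  have hcont : Continuous fun t : ℝ => fderiv ℝ φ (x + t • z) z :=
    ((hφ.continuous_fderiv one_ne_zero).comp (by fun_prop)).clm_apply continuous_const
  have hftc : ∫ t in Ioc (0 : ℝ) 1, fderiv ℝ φ (x + t • z) z = φ (x + z) - φ x := by
    rw [← intervalIntegral.integral_of_le zero_le_one,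
      intervalIntegral.integral_eq_sub_of_hasDerivAt (fun t _ => hderiv t)
        (hcont.intervalIntegrable _ _)]
    simp
  have : IsProbabilityMeasure (volume.restrict (Ioc (0 : ℝ) 1)) := ⟨by simp⟩
  rw [← hftc, ← lintegral_const_mul' _ _ (by simp)]
  refine (enorm_integral_sq_le hcont.aestronglyMeasurable).trans (lintegral_mono fun t => ?_)
  rw [← mul_pow, mul_comm]
  gcongr
  exact ContinuousLinearMap.le_opENorm _ _

variable [MeasurableSpace E] [BorelSpace E] [FiniteDimensional ℝ E]

lemma eLpNorm_add_sub_le (μ : Measure E) [μ.IsAddHaarMeasure] {φ : E → F} (hφ : ContDiff ℝ 1 φ)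
    (z : E) :
    eLpNorm (fun x => φ (x + z) - φ x) 2 μ ≤ ‖z‖ₑ * eLpNorm (fderiv ℝ φ) 2 μ := by
  have hmeas : Measurable fun p : E × ℝ => ‖fderiv ℝ φ (p.1 + p.2 • z)‖ₑ ^ 2 :=
    (((hφ.continuous_fderiv one_ne_zero).comp (by fun_prop)).enorm.measurable).pow_const 2
  rw [eLpNorm_two_le_iff, mul_pow, eLpNorm_two_sq]
  calc ∫⁻ x, ‖φ (x + z) - φ x‖ₑ ^ 2 ∂μ
      ≤ ∫⁻ x, (‖z‖ₑ ^ 2 * ∫⁻ t in Ioc (0 : ℝ) 1, ‖fderiv ℝ φ (x + t • z)‖ₑ ^ 2) ∂μ :=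
        lintegral_mono fun x => enorm_add_sub_sq_le_lintegral_fderiv hφ x z
    _ = ‖z‖ₑ ^ 2 * ∫⁻ t in Ioc (0 : ℝ) 1, (∫⁻ x, ‖fderiv ℝ φ (x + t • z)‖ₑ ^ 2 ∂μ) := by
        rw [lintegral_const_mul' _ _ (by simp), lintegral_lintegral_swap hmeas.aemeasurable]
    _ = ‖z‖ₑ ^ 2 * ∫⁻ _ in Ioc (0 : ℝ) 1, (∫⁻ x, ‖fderiv ℝ φ x‖ₑ ^ 2 ∂μ) := by
        congr! 3 with t
        exact lintegral_add_right_eq_self (fun x => ‖fderiv ℝ φ x‖ₑ ^ 2) (t • z)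
    _ = ‖z‖ₑ ^ 2 * ∫⁻ x, ‖fderiv ℝ φ x‖ₑ ^ 2 ∂μ := by simp

end Translation

section Poincare

variable {d : ℕ} {Ω : Set (Eucl d)}

lemma support_gradient_subset (φ : Eucl d → ℝ) : Function.support (gradient φ) ⊆ tsupport φ := by
  refine fun x hx => support_fderiv_subset ℝ fun h => hx ?_
  simp [gradient, h]

lemma enorm_eq_eLpNorm_of_ae_eq {α F : Type*} [MeasurableSpace α] [NormedAddCommGroup F]
    {μ : Measure α} {s : Set α} {p : ℝ≥0∞} {f : Lp F p (μ.restrict s)} {φ : α → F}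
    (hf : f =ᵐ[μ.restrict s] φ) (hφ : Function.support φ ⊆ s) : ‖f‖ₑ = eLpNorm φ p μ := by
  rw [Lp.enorm_def, eLpNorm_congr_ae hf, eLpNorm_restrict_eq_of_support_subset hφ]

lemma enorm_snd_eq_eLpNorm_fderiv {v : GradPair Ω} {φ : Eucl d → ℝ} (hφ : tsupport φ ⊆ Ω)
    (hv : v.snd =ᵐ[volume.restrict Ω] gradient φ) : ‖v.snd‖ₑ = eLpNorm (fderiv ℝ φ) 2 := by
  rw [enorm_eq_eLpNorm_of_ae_eq hv ((support_gradient_subset φ).trans hφ)]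
  exact eLpNorm_congr_norm_ae (Eventually.of_forall fun x => by simp [gradient])

lemma isClosed_H10 : IsClosed (H10 Ω : Set (GradPair Ω)) :=
  Submodule.isClosed_topologicalClosure _

lemma exists_hasPoincare_H10 (hd : 1 ≤ d) (hΩ : Bornology.IsBounded Ω) :
    ∃ C, HasPoincare (H10 Ω) C := by
  have : Nonempty (Fin d) := ⟨⟨0, hd⟩⟩
  obtain ⟨R, hR⟩ := hΩ.exists_norm_le
  obtain ⟨z, hz⟩ := NormedSpace.exists_lt_norm ℝ (Eucl d) (2 * R)
  refine ⟨‖z‖₊, fun v hv => closure_minimal (t := {v : GradPair Ω | ‖v.fst‖ ≤ ‖z‖₊ * ‖v.snd‖}) ?_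
    (isClosed_le (WithLp.continuous_fst 2 _ _).norm
      (continuous_const.mul (WithLp.continuous_snd 2 _ _).norm)) hv⟩
  rintro v ⟨φ, hsmooth, -, hsupp, hfst, hsnd⟩
  have hφ : Function.support φ ⊆ Ω := (subset_tsupport φ).trans hsupp
  -- The translate by `z` moves the support of `φ` off itself.
  have hle (x : Eucl d) : ‖φ x‖ₑ ≤ ‖φ (x + z) - φ x‖ₑ := by
    by_cases hx : φ x = 0
    · simp [hx]
    · have hxz : φ (x + z) = 0 := by
        by_contra h
        have htri := norm_sub_le (x + z) x
        rw [add_sub_cancel_left] at htri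
        linarith [hR x (hφ hx), hR _ (hφ h)]
      simp [hxz]
  have key : ‖v.fst‖ₑ ≤ ‖z‖ₑ * ‖v.snd‖ₑ := by
    rw [enorm_eq_eLpNorm_of_ae_eq hfst hφ, enorm_snd_eq_eLpNorm_fderiv hsupp hsnd]
    exact (eLpNorm_mono_enorm hle).trans
      (eLpNorm_add_sub_le volume (hsmooth.of_le (by simp)) z)
  simp only [enorm_eq_nnnorm] at key
  change ‖v.fst‖ ≤ ‖z‖₊ * ‖v.snd‖
  exact_mod_cast key

end Poincare

section CellAverages

variable {α κ F : Type*} [MeasurableSpace α] [NormedAddCommGroup F] [NormedSpace ℝ F]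
  {μ : Measure α}

lemma exists_finiteDimensional_comp_mem [IsFiniteMeasure μ] [MeasurableSpace κ]
    [MeasurableSingletonClass κ] {c : α → κ} (hc : Measurable c) {s : Set κ} (hs : s.Finite)
    (hcs : ∀ᵐ x ∂μ, c x ∈ s) :
    ∃ X : Submodule ℝ (Lp ℝ 2 μ), FiniteDimensional ℝ X ∧
      ∀ a : κ → ℝ, ∃ y ∈ X, y =ᵐ[μ] fun x => a (c x) := by
  let ind (k : κ) : Lp ℝ 2 μ :=
    indicatorConstLp 2 (hc (measurableSet_singleton k)) (measure_ne_top μ _) 1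
  refine ⟨Submodule.span ℝ (ind '' s), FiniteDimensional.span_of_finite ℝ (hs.image _),
    fun a => ⟨∑ k ∈ hs.toFinset, a k • ind k, ?_, ?_⟩⟩
  · exact Submodule.sum_mem _ fun k hk => Submodule.smul_mem _ _
      (Submodule.subset_span (mem_image_of_mem _ (hs.mem_toFinset.1 hk)))
  · have hind : ∀ᵐ x ∂μ, ∀ k ∈ hs.toFinset,
        (a k • ind k : Lp ℝ 2 μ) x = (c ⁻¹' {k}).indicator (fun _ => a k) x :=
      (Finset.eventually_all _).2 fun k _ => by
        filter_upwards [Lp.coeFn_smul (a k) (ind k), indicatorConstLp_coeFn (p := 2)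
          (hs := hc (measurableSet_singleton k)) (hμs := measure_ne_top μ _) (c := (1 : ℝ))]
          with x hsmul hx
        rw [hsmul, Pi.smul_apply, hx, ← indicator_const_smul_apply, smul_eq_mul, mul_one]
    filter_upwards [hcs, hind, Lp.coeFn_finsetSum hs.toFinset fun k => a k • ind k]
      with x hx hind hsum
    rw [hsum, Finset.sum_apply, Finset.sum_congr rfl hind, Finset.sum_eq_single (c x)]
    · simp
    · exact fun k _ hk => indicator_of_notMem (fun h => hk h.symm) _
    · exact fun h => (h (hs.mem_toFinset.2 hx)).elim

lemma enorm_sub_setAverage_sq_le [CompleteSpace F] {f : α → F} {s : Set α} (h0 : μ s ≠ 0)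
    (hs : μ s ≠ ⊤) (hf : IntegrableOn f s μ) (y : F) :
    ‖y - ⨍ x in s, f x ∂μ‖ₑ ^ 2 ≤ (μ s)⁻¹ * ∫⁻ x in s, ‖f x - y‖ₑ ^ 2 ∂μ := by
  have : IsFiniteMeasure (μ.restrict s) := ⟨by simpa using hs.lt_top⟩
  have : NeZero (μ.restrict s) := ⟨by simpa using h0⟩
  have hsub : ⨍ x in s, (f x - y) ∂μ = (⨍ x in s, f x ∂μ) - y := by
    have hconst := setAverage_const h0 hs y
    rw [setAverage_eq] at hconst ⊢
    rw [integral_sub hf (integrable_const y), smul_sub, hconst, setAverage_eq]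
  rw [enorm_sub_rev, ← hsub, average]
  refine (enorm_integral_sq_le
    ((hf.aestronglyMeasurable.sub aestronglyMeasurable_const).smul_measure _)).trans_eq ?_
  rw [lintegral_smul_measure, Measure.restrict_apply_univ]
  rfl

variable {E : Type*} [NormedAddCommGroup E] [NormedSpace ℝ E] [MeasurableSpace E] [BorelSpace E]
  [FiniteDimensional ℝ E] [CompleteSpace F]

lemma eLpNorm_sub_average_sq_le (μ : Measure E) [μ.IsAddHaarMeasure] {c : E → κ} {r : ℝ≥0}
    {m : ℝ≥0∞} (hm : m ≠ 0) (hcr : ∀ x, c ⁻¹' {c x} ⊆ Metric.closedBall x r)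
    (hcm : ∀ x, m ≤ μ (c ⁻¹' {c x})) {φ : E → F} (hφ : ContDiff ℝ 1 φ)
    (hφc : HasCompactSupport φ) :
    eLpNorm (fun x => φ x - ⨍ y in c ⁻¹' {c x}, φ y ∂μ) 2 μ ^ 2 ≤
      m⁻¹ * μ (Metric.closedBall 0 r) * (r * eLpNorm (fderiv ℝ φ) 2 μ) ^ 2 := by
  have hpoint (x : E) : ‖φ x - ⨍ y in c ⁻¹' {c x}, φ y ∂μ‖ₑ ^ 2 ≤
      m⁻¹ * ∫⁻ z in Metric.closedBall (0 : E) r, ‖φ (x + z) - φ x‖ₑ ^ 2 ∂μ := by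
    have htop : μ (c ⁻¹' {c x}) ≠ ⊤ :=
      measure_ne_top_of_subset (hcr x) Metric.isBounded_closedBall.measure_lt_top.ne
    refine (enorm_sub_setAverage_sq_le ((pos_iff_ne_zero.2 hm).trans_le (hcm x)).ne' htop
      (hφ.continuous.integrable_of_hasCompactSupport hφc).integrableOn (φ x)).trans
      (mul_le_mul' (ENNReal.inv_le_inv.2 (hcm x)) ?_)
    have hshift := (measurePreserving_add_left μ x).setLIntegral_comp_preimage
      (s := Metric.closedBall x r) Metric.isClosed_closedBall.measurableSet
      ((hφ.continuous.sub continuous_const).enorm.measurable.pow_const 2 :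
        Measurable fun y => ‖φ y - φ x‖ₑ ^ 2)
    rw [preimage_add_closedBall, sub_self] at hshift
    exact (lintegral_mono_set (hcr x)).trans_eq hshift.symm
  have hmeas : Measurable fun p : E × E => ‖φ (p.1 + p.2) - φ p.1‖ₑ ^ 2 :=
    ((hφ.continuous.comp continuous_add).sub
      (hφ.continuous.comp continuous_fst)).enorm.measurable.pow_const 2
  rw [eLpNorm_two_sq, mul_assoc]
  calc ∫⁻ x, ‖φ x - ⨍ y in c ⁻¹' {c x}, φ y ∂μ‖ₑ ^ 2 ∂μ
      ≤ ∫⁻ x, (m⁻¹ * ∫⁻ z in Metric.closedBall (0 : E) r, ‖φ (x + z) - φ x‖ₑ ^ 2 ∂μ) ∂μ :=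
        lintegral_mono hpoint
    _ = m⁻¹ * ∫⁻ z in Metric.closedBall (0 : E) r, (∫⁻ x, ‖φ (x + z) - φ x‖ₑ ^ 2 ∂μ) ∂μ := by
        rw [lintegral_const_mul' _ _ (ENNReal.inv_ne_top.2 hm),
          lintegral_lintegral_swap hmeas.aemeasurable]
    _ ≤ m⁻¹ * ∫⁻ _ in Metric.closedBall (0 : E) r, (r * eLpNorm (fderiv ℝ φ) 2 μ) ^ 2 ∂μ := by
        refine mul_le_mul_right (setLIntegral_mono measurable_const fun z hz => ?_) _
        rw [← eLpNorm_two_sq]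
        gcongr
        refine (eLpNorm_add_sub_le μ hφ z).trans ?_
        gcongr
        rw [enorm_eq_nnnorm, ENNReal.coe_le_coe]
        exact mem_closedBall_zero_iff.1 hz
    _ = _ := by rw [setLIntegral_const, mul_comm (_ ^ 2)]

end CellAverages

section Rellich

variable {d : ℕ} {Ω : Set (Eucl d)}

/-- The index of the cubic cell of side length `η` that contains a point. -/
def cellIndex (η : ℝ) (x : Eucl d) : Fin d → ℤ := fun i => ⌊x i / η⌋

lemma measurable_cellIndex (η : ℝ) : Measurable (cellIndex η : Eucl d → Fin d → ℤ) :=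
  measurable_pi_iff.2 fun i => Int.measurable_floor.comp
    (by fun_prop : Continuous fun x : Eucl d => x i / η).measurable

lemma cellIndex_preimage_subset_closedBall {η : ℝ} (hη : 0 < η) (x : Eucl d) :
    cellIndex η ⁻¹' {cellIndex η x} ⊆ Metric.closedBall x (d * η) := by
  intro y hy
  have hcoord (i : Fin d) : ‖(y - x) i‖ ≤ η := by
    have h := Int.abs_sub_lt_one_of_floor_eq_floor (congrFun hy i)
    rw [← sub_div, abs_div, abs_of_pos hη, div_lt_one hη] at h
    exact h.le
  rw [mem_closedBall_iff_norm]
  refine le_of_sq_le_sq ?_ (by positivity)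
  calc ‖y - x‖ ^ 2 = ∑ i, ‖(y - x) i‖ ^ 2 := EuclideanSpace.norm_sq_eq _
    _ ≤ ∑ _i : Fin d, η ^ 2 := by gcongr with i; exact hcoord i
    _ = d * η ^ 2 := by simp
    _ ≤ d ^ 2 * η ^ 2 := by gcongr; exact_mod_cast Nat.le_self_pow two_ne_zero d
    _ = (d * η) ^ 2 := (mul_pow _ _ _).symm

lemma exists_closedBall_subset_cellIndex_preimage {η : ℝ} (hη : 0 < η) (x : Eucl d) :
    ∃ m : Eucl d, Metric.closedBall m (η / 4) ⊆ cellIndex η ⁻¹' {cellIndex η x} := by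
  set m : Eucl d := WithLp.toLp 2 fun i => (cellIndex η x i + 1 / 2) * η
  refine ⟨m, fun y hy => funext fun i => Int.floor_eq_iff.2 ?_⟩
  have hyi := abs_le.1 ((PiLp.norm_apply_le (y - m) i).trans (mem_closedBall_iff_norm.1 hy))
  have hmi : (y - m) i = y i - (cellIndex η x i + 1 / 2) * η := rfl
  rw [le_div_iff₀ hη, div_lt_iff₀ hη]
  constructor <;> linarith

lemma finite_cellIndex_image (hΩ : Bornology.IsBounded Ω) {η : ℝ} (hη : 0 < η) :
    (cellIndex η '' Ω).Finite := by
  obtain ⟨R, hR⟩ := hΩ.exists_norm_le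
  refine (finite_Icc (fun _ : Fin d => ⌊-R / η⌋) fun _ => ⌊R / η⌋).subset ?_
  rintro _ ⟨x, hx, rfl⟩
  have hxi (i : Fin d) := abs_le.1 ((PiLp.norm_apply_le x i).trans (hR x hx))
  exact ⟨fun i => Int.floor_le_floor (div_le_div_of_nonneg_right (hxi i).1 hη.le),
    fun i => Int.floor_le_floor (div_le_div_of_nonneg_right (hxi i).2 hη.le)⟩

lemma eLpNorm_sub_cellAverage_le {η : ℝ≥0} (hη : 0 < η) {φ : Eucl d → ℝ} (hφ : ContDiff ℝ 1 φ)
    (hφc : HasCompactSupport φ) :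
    eLpNorm (fun x => φ x - ⨍ y in cellIndex η ⁻¹' {cellIndex η x}, φ y) 2 ≤
      (NNReal.sqrt ((4 * d) ^ d) * (d * η) : ℝ≥0) * eLpNorm (fderiv ℝ φ) 2 := by
  set m := volume (Metric.closedBall (0 : Eucl d) (η / 4))
  have hm0 : m ≠ 0 := (Metric.measure_closedBall_pos volume _ (by positivity)).ne'
  have hmtop : m ≠ ⊤ := Metric.isBounded_closedBall.measure_lt_top.ne
  have hcell (x : Eucl d) : m ≤ volume (cellIndex η ⁻¹' {cellIndex η x}) := by
    obtain ⟨y, hy⟩ := exists_closedBall_subset_cellIndex_preimage hη x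
    exact (Measure.addHaar_closedBall_center volume y _).symm.trans_le (measure_mono hy)
  set c : ℝ≥0 := NNReal.sqrt ((4 * d) ^ d)
  have hc : c ^ 2 = (4 * d) ^ d := NNReal.sq_sqrt _
  have hratio : volume (Metric.closedBall (0 : Eucl d) (d * η : ℝ≥0)) = m * (c ^ 2 : ℝ≥0) := by
    rw [hc, Measure.addHaar_closedBall _ _ (by positivity),
      show m = _ from Measure.addHaar_closedBall _ _ (by positivity), mul_right_comm,
      ← ENNReal.ofReal_coe_nnreal, ← ENNReal.ofReal_mul (by positivity),
      finrank_euclideanSpace_fin]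
    push_cast
    rw [← mul_pow]
    congr 3
    ring
  refine (ENNReal.pow_le_pow_left_iff two_ne_zero).1 ((eLpNorm_sub_average_sq_le volume
    (c := cellIndex η) (r := d * η) hm0 ?_ hcell hφ hφc).trans_eq ?_)
  · exact_mod_cast cellIndex_preimage_subset_closedBall hη
  · rw [hratio, ← mul_assoc, ENNReal.inv_mul_cancel hm0 hmtop, one_mul, ENNReal.coe_pow,
      ENNReal.coe_mul c]
    ring

lemma compactlyEmbedded_H10 (hΩo : IsOpen Ω) (hΩ : Bornology.IsBounded Ω) :
    CompactlyEmbedded (H10 Ω) := by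
  intro τ hτ
  have : IsFiniteMeasure (volume.restrict Ω) := ⟨by simpa using hΩ.measure_lt_top⟩
  set K : ℝ≥0 := NNReal.sqrt ((4 * d) ^ d) * d with hK
  set η : ℝ≥0 := τ / (K + 1) with hη
  have hη0 : 0 < η := by positivity
  have hKη : NNReal.sqrt ((4 * d) ^ d) * (d * η) ≤ τ := by
    rw [← mul_assoc, ← hK, hη, ← mul_div_assoc]
    exact div_le_of_le_mul₀ (by positivity) (by positivity) (by nlinarith)
  obtain ⟨X, hXfin, hX⟩ := exists_finiteDimensional_comp_mem (μ := volume.restrict Ω)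
    (measurable_cellIndex η) (finite_cellIndex_image hΩ hη0)
    ((ae_restrict_mem hΩo.measurableSet).mono fun x hx => mem_image_of_mem _ hx)
  refine ⟨X, hXfin, fun v hv => ⟨X.starProjection v.fst, X.starProjection_apply_mem _, ?_⟩⟩
  refine closure_minimal (t := {v : GradPair Ω | ‖v.fst - X.starProjection v.fst‖ ≤ τ * ‖v.snd‖})
    ?_ (isClosed_le ?_ (continuous_const.mul (WithLp.continuous_snd 2 _ _).norm)) hv
  · rintro v ⟨φ, hsmooth, hcomp, hsupp, hfst, hsnd⟩
    obtain ⟨y, hyX, hy⟩ := hX fun k => ⨍ x in cellIndex η ⁻¹' {k}, φ x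
    have key : ‖v.fst - y‖ₑ ≤ τ * ‖v.snd‖ₑ := by
      rw [Lp.enorm_def, eLpNorm_congr_ae ((Lp.coeFn_sub _ _).trans (hfst.sub hy)),
        enorm_snd_eq_eLpNorm_fderiv hsupp hsnd]
      refine (eLpNorm_mono_measure _ Measure.restrict_le_self).trans
        ((eLpNorm_sub_cellAverage_le hη0 (hsmooth.of_le (by simp)) hcomp).trans ?_)
      gcongr
    simp only [enorm_eq_nnnorm] at key
    calc ‖v.fst - X.starProjection v.fst‖ ≤ ‖v.fst - y‖ := by
          rw [X.starProjection_minimal]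
          exact ciInf_le ⟨0, by rintro _ ⟨z, rfl⟩; exact norm_nonneg _⟩ (⟨y, hyX⟩ : X)
      _ ≤ τ * ‖v.snd‖ := by exact_mod_cast key
  · have hfst := WithLp.continuous_fst 2 (L2 Ω) (L2Vec Ω)
    exact (hfst.sub (X.starProjection.continuous.comp hfst)).norm

end Rellich

section Mollification

open scoped Convolution

lemma tendsto_toLp_of_norm_le {α F : Type*} [MeasurableSpace α] [NormedAddCommGroup F]
    {μ : Measure α} [IsFiniteMeasure μ] {p : ℝ≥0∞} [Fact (1 ≤ p)] (hp : p ≠ ⊤) {f : ℕ → α → F}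
    {g : α → F} {M : ℝ≥0} (hf : ∀ n, MemLp (f n) p μ) (hg : MemLp g p μ)
    (hM : ∀ n x, ‖f n x‖ ≤ M) (hlim : ∀ᵐ x ∂μ, Tendsto (fun n => f n x) atTop (𝓝 (g x))) :
    Tendsto (fun n => (hf n).toLp (f n)) atTop (𝓝 (hg.toLp g)) := by
  have hUI : UnifIntegrable f p μ := by
    refine unifIntegrable_of Fact.out hp (fun n => (hf n).1) fun ε _ => ⟨M + 1, fun n => ?_⟩
    have hempty : {x | M + 1 ≤ ‖f n x‖₊} = ∅ :=
      eq_empty_of_forall_notMem fun x hx => (hx.trans (hM n x)).not_gt (lt_add_one M)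
    simp [hempty]
  rw [Lp.tendsto_Lp_iff_tendsto_eLpNorm'']
  exact tendsto_Lp_finite_of_tendsto_ae Fact.out hp (fun n => (hf n).1) hg hUI hlim

variable {E : Type*} [NormedAddCommGroup E] [NormedSpace ℝ E] [FiniteDimensional ℝ E]
  [MeasurableSpace E] [BorelSpace E] (φ : ContDiffBump (0 : E)) (μ : Measure E) [μ.IsAddHaarMeasure]

lemma norm_normed_convolution_le {F : Type*} [NormedAddCommGroup F] [NormedSpace ℝ F]
    {g : E → F} {M : ℝ} (hg : ∀ x, ‖g x‖ ≤ M) (x : E) :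
    ‖(φ.normed μ ⋆[ContinuousLinearMap.lsmul ℝ ℝ, μ] g) x‖ ≤ M := by
  refine (norm_integral_le_of_norm_le (φ.integrable_normed.mul_const M) <|
    Eventually.of_forall fun t => ?_).trans_eq ?_
  · rw [ContinuousLinearMap.lsmul_apply, norm_smul, Real.norm_of_nonneg (φ.nonneg_normed t)]
    exact mul_le_mul_of_nonneg_left (hg _) (φ.nonneg_normed t)
  · rw [integral_mul_const, φ.integral_normed, one_mul]

lemma hasFDerivAt_normed_convolution {w : E → ℝ} {K : ℝ≥0} (hw : LipschitzWith K w) (x : E) :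
    HasFDerivAt (φ.normed μ ⋆[ContinuousLinearMap.lsmul ℝ ℝ, μ] w)
      ((φ.normed μ ⋆[ContinuousLinearMap.lsmul ℝ ℝ, μ] fderiv ℝ w) x) x := by
  have hcont (y : E) : Continuous fun t => φ.normed μ t • w (y - t) :=
    φ.continuous_normed.smul (hw.continuous.comp (continuous_const.sub continuous_id))
  have hmeas : AEStronglyMeasurable (fun t => φ.normed μ t • fderiv ℝ w (x - t)) μ :=
    φ.continuous_normed.aestronglyMeasurable.smul
      ((measurable_fderiv ℝ w).comp (measurable_const.sub measurable_id)).aestronglyMeasurable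
  have hlip (t : E) : LipschitzWith (Real.nnabs (φ.normed μ t * K))
      fun y => φ.normed μ t • w (y - t) := by
    refine LipschitzWith.of_dist_le_mul fun y z => ?_
    have hle := hw.dist_le_mul (y - t) (z - t)
    rw [dist_sub_right] at hle
    rw [dist_smul₀, Real.norm_eq_abs, Real.coe_nnabs, abs_mul, NNReal.abs_eq, mul_assoc]
    gcongr
  have hrademacher : ∀ᵐ t ∂μ, DifferentiableAt ℝ w (x - t) :=
    (Measure.measurePreserving_sub_left μ x).quasiMeasurePreserving.ae hw.ae_differentiableAt
  refine (hasFDerivAt_integral_of_dominated_loc_of_lip (bound := fun t => φ.normed μ t * K)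
    univ_mem (Eventually.of_forall fun y => (hcont y).aestronglyMeasurable)
    ((hcont x).integrable_of_hasCompactSupport φ.hasCompactSupport_normed.smul_right) hmeas
    (Eventually.of_forall fun t => (hlip t).lipschitzOnWith)
    (φ.integrable_normed.mul_const _) ?_).2
  filter_upwards [hrademacher] with t ht
  exact (ht.hasFDerivAt.comp x ((hasFDerivAt_id x).sub_const t)).const_smul (φ.normed μ t)

lemma tsupport_normed_convolution_subset (w : E → ℝ) :
    tsupport (φ.normed μ ⋆[ContinuousLinearMap.lsmul ℝ ℝ, μ] w) ⊆
      Metric.cthickening φ.rOut (tsupport w) := by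
  refine closure_minimal (fun x hx => ?_) Metric.isClosed_cthickening
  obtain ⟨a, ha, b, hb, rfl⟩ := support_convolution_subset _ hx
  refine Metric.mem_cthickening_of_dist_le _ b _ _ (subset_tsupport _ hb) ?_
  rw [φ.support_normed_eq, mem_ball_zero_iff] at ha
  simpa [dist_eq_norm] using ha.le

variable {d : ℕ} {Ω : Set (Eucl d)}

lemma measurable_gradient (w : Eucl d → ℝ) : Measurable (gradient w) :=
  (InnerProductSpace.toDual ℝ (Eucl d)).symm.continuous.measurable.comp (measurable_fderiv ℝ w)

lemma exists_mem_H10_of_tendsto_ae [IsFiniteMeasure (volume.restrict Ω)] {f : ℕ → Eucl d → ℝ}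
    {w : Eucl d → ℝ} {M K : ℝ≥0} (hf : ∀ n, ContDiff ℝ ∞ (f n))
    (hfc : ∀ n, HasCompactSupport (f n)) (hfΩ : ∀ n, tsupport (f n) ⊆ Ω)
    (hfM : ∀ n x, ‖f n x‖ ≤ M) (hfK : ∀ n x, ‖gradient (f n) x‖ ≤ K)
    (hfw : ∀ᵐ x ∂volume, Tendsto (fun n => f n x) atTop (𝓝 (w x)))
    (hgrad : ∀ᵐ x ∂volume, Tendsto (fun n => gradient (f n) x) atTop (𝓝 (gradient w x))) :
    ∃ p ∈ H10 Ω, p.fst =ᵐ[volume.restrict Ω] w ∧ p.snd =ᵐ[volume.restrict Ω] gradient w := by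
  replace hfw := ae_restrict_of_ae (s := Ω) hfw
  replace hgrad := ae_restrict_of_ae (s := Ω) hgrad
  have hfm (n) : AEStronglyMeasurable (f n) (volume.restrict Ω) :=
    (hf n).continuous.aestronglyMeasurable
  have hfL (n) : MemLp (f n) 2 (volume.restrict Ω) :=
    .of_bound (hfm n) M (Eventually.of_forall (hfM n))
  have hgL (n) : MemLp (gradient (f n)) 2 (volume.restrict Ω) :=
    .of_bound (measurable_gradient _).aestronglyMeasurable K (Eventually.of_forall (hfK n))
  have hwL : MemLp w 2 (volume.restrict Ω) :=
    .of_bound (aestronglyMeasurable_of_tendsto_ae atTop hfm hfw) M <|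
      hfw.mono fun x hx => le_of_tendsto hx.norm (Eventually.of_forall fun n => hfM n x)
  have hGL : MemLp (gradient w) 2 (volume.restrict Ω) :=
    .of_bound (measurable_gradient w).aestronglyMeasurable K <|
      hgrad.mono fun x hx => le_of_tendsto hx.norm (Eventually.of_forall fun n => hfK n x)
  refine ⟨WithLp.toLp 2 (hwL.toLp w, hGL.toLp (gradient w)), ?_, hwL.coeFn_toLp, hGL.coeFn_toLp⟩
  refine mem_closure_of_tendsto (((WithLp.prod_continuous_toLp 2 _ _).tendsto _).comp
    ((tendsto_toLp_of_norm_le ENNReal.ofNat_ne_top hfL hwL hfM hfw).prodMk_nhds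
      (tendsto_toLp_of_norm_le ENNReal.ofNat_ne_top hgL hGL hfK hgrad))) ?_
  exact Eventually.of_forall fun n =>
    ⟨f n, hf n, hfc n, hfΩ n, (hfL n).coeFn_toLp, (hgL n).coeFn_toLp⟩

lemma locallyIntegrable_fderiv_of_lipschitz {w : Eucl d → ℝ} {K : ℝ≥0} (hw : LipschitzWith K w) :
    LocallyIntegrable (fderiv ℝ w) (volume : Measure (Eucl d)) :=
  (locallyIntegrable_const (K : ℝ)).mono (measurable_fderiv ℝ w).aestronglyMeasurable <|
    Eventually.of_forall fun x => by simpa using norm_fderiv_le_of_lipschitz ℝ hw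

lemma exists_mem_H10_of_lipschitz (hΩo : IsOpen Ω) (hΩ : Bornology.IsBounded Ω)
    {w : Eucl d → ℝ} {K : ℝ≥0} (hw : LipschitzWith K w) (hsupp : tsupport w ⊆ Ω) :
    ∃ p ∈ H10 Ω, p.fst =ᵐ[volume.restrict Ω] w ∧ p.snd =ᵐ[volume.restrict Ω] gradient w := by
  have : IsFiniteMeasure (volume.restrict Ω) := ⟨by simpa using hΩ.measure_lt_top⟩
  have hcs : HasCompactSupport w :=
    Metric.isCompact_of_isClosed_isBounded (isClosed_tsupport w) (hΩ.subset hsupp)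
  obtain ⟨M, hM⟩ := hcs.exists_bound_of_continuous hw.continuous
  obtain ⟨r, hr, hrΩ⟩ := hcs.exists_cthickening_subset_open hΩo hsupp
  have hρ (n : ℕ) : 0 < r / (n + 1) := by positivity
  let φ (n : ℕ) : ContDiffBump (0 : Eucl d) := ⟨_, _, half_pos (hρ n), half_lt_self (hρ n)⟩
  have hφr (n) : (φ n).rOut ≤ r := div_le_self hr.le (by simp)
  have hφ0 : Tendsto (fun n => (φ n).rOut) atTop (𝓝 0) := by
    simpa [φ, div_eq_mul_inv] using
      (tendsto_one_div_add_atTop_nhds_zero_nat (𝕜 := ℝ)).const_mul r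
  have hφ2 : ∀ᶠ n in atTop, (φ n).rOut ≤ 2 * (φ n).rIn :=
    Eventually.of_forall fun n => (mul_div_cancel₀ _ two_ne_zero).ge
  let f (n : ℕ) := (φ n).normed volume ⋆[ContinuousLinearMap.lsmul ℝ ℝ, volume] w
  have hfderiv (n) : fderiv ℝ (f n) =
      (φ n).normed volume ⋆[ContinuousLinearMap.lsmul ℝ ℝ, volume] fderiv ℝ w :=
    funext fun x => (hasFDerivAt_normed_convolution (φ n) volume hw x).fderiv
  have hf_subset (n) : tsupport (f n) ⊆ Metric.cthickening r (tsupport w) :=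
    (tsupport_normed_convolution_subset _ _ w).trans (Metric.cthickening_mono (hφr n) _)
  refine exists_mem_H10_of_tendsto_ae (f := f) (M := M.toNNReal) (K := K)
    (fun n => (φ n).hasCompactSupport_normed.contDiff_convolution_left _ (φ n).contDiff_normed
      hw.continuous.locallyIntegrable)
    (fun n => hcs.cthickening.of_isClosed_subset (isClosed_tsupport _) (hf_subset n))
    (fun n => (hf_subset n).trans hrΩ)
    (fun n => norm_normed_convolution_le _ _ fun x => (hM x).trans (le_max_left M 0))
    (fun n x => ?_)
    (ContDiffBump.ae_convolution_tendsto_right_of_locallyIntegrable hφ0 hφ2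
      hw.continuous.locallyIntegrable) ?_
  · rw [gradient, LinearIsometryEquiv.norm_map, hfderiv]
    exact norm_normed_convolution_le _ _ (fun _ => norm_fderiv_le_of_lipschitz ℝ hw) x
  · filter_upwards [ContDiffBump.ae_convolution_tendsto_right_of_locallyIntegrable hφ0 hφ2
      (locallyIntegrable_fderiv_of_lipschitz hw)] with x hx
    simp only [gradient, hfderiv]
    exact ((LinearIsometryEquiv.continuous _).tendsto _).comp hx

end Mollification

section AffineApproximation

variable {E F : Type*} [NormedAddCommGroup E] [NormedSpace ℝ E] [NormedAddCommGroup F]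
  [NormedSpace ℝ F]

lemma lipschitzWith_of_finite_closed_cover {ι Y : Type*} [Finite ι] [PseudoMetricSpace Y]
    {A : ι → Set E} (hA : ∀ i, IsClosed (A i)) (hcov : ⋃ i, A i = univ) {w : E → Y} {K : ℝ≥0}
    (hw : ∀ i, LipschitzOnWith K w (A i)) : LipschitzWith K w := by
  have hwc : Continuous w :=
    (locallyFinite_of_finite A).continuous hcov hA fun i => (hw i).continuousOn
  refine LipschitzWith.of_dist_le_mul fun x y => ?_
  let γ : ℝ →ᵃ[ℝ] E := AffineMap.lineMap x y
  have hγ : Continuous γ := AffineMap.lineMap_continuous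
  have hγw : Continuous fun t => dist (w (γ 0)) (w (γ t)) := continuous_const.dist (hwc.comp hγ)
  let S : Set ℝ := {t | dist (w (γ 0)) (w (γ t)) ≤ K * (t * dist x y)}
  have hS : IsClosed S := isClosed_le hγw (by fun_prop)
  suffices hIcc : Icc 0 1 ⊆ S by simpa [S, γ] using hIcc (right_mem_Icc.2 zero_le_one)
  refine IsClosed.Icc_subset_of_forall_exists_gt (hS.inter isClosed_Icc) (by simp [S])
    fun t ⟨ht, _⟩ b hb => ?_
  obtain ⟨i, hi⟩ : ∃ i, ∃ᶠ z in 𝓝[>] t, γ z ∈ A i := by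
    by_contra! hnot
    obtain ⟨z, hz⟩ := (eventually_all.2 hnot).exists
    obtain ⟨i, hi⟩ := iUnion_eq_univ_iff.1 hcov (γ z)
    exact hz i hi
  have hti : γ t ∈ A i := (hA i).mem_of_frequently_of_tendsto hi
    ((hγ.tendsto t).mono_left nhdsWithin_le_nhds)
  obtain ⟨z, hzi, htz, hzb⟩ := (hi.and_eventually (Ioc_mem_nhdsGT hb)).exists
  refine ⟨z, ?_, htz, hzb⟩
  calc dist (w (γ 0)) (w (γ z))
      ≤ dist (w (γ 0)) (w (γ t)) + dist (w (γ t)) (w (γ z)) := dist_triangle _ _ _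
    _ ≤ K * (t * dist x y) + K * ((z - t) * dist x y) := by
      refine add_le_add ht (((hw i).dist_le_mul _ hti _ hzi).trans_eq ?_)
      rw [dist_lineMap_lineMap, dist_comm t z, Real.dist_eq, abs_of_pos (sub_pos.2 htz)]
    _ = K * (z * dist x y) := by ring

lemma norm_le_of_mem_convexHull {V : Type*} [AddCommGroup V] [Module ℝ V] (g : V →ᵃ[ℝ] F)
    {s : Set V} {M : ℝ} (hs : ∀ v ∈ s, ‖g v‖ ≤ M) {x : V} (hx : x ∈ convexHull ℝ s) :
    ‖g x‖ ≤ M := by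
  have hsub : convexHull ℝ s ⊆ g ⁻¹' Metric.closedBall 0 M :=
    convexHull_min (fun v hv => mem_closedBall_zero_iff.2 (hs v hv))
      ((convex_closedBall _ _).affine_preimage g)
  exact mem_closedBall_zero_iff.1 (hsub hx)

lemma norm_contLinear_le_of_closedBall (g : E →ᴬ[ℝ] F) {c : E} {r M : ℝ} (hr : 0 < r)
    (hg : ∀ y ∈ Metric.closedBall c r, ‖g y‖ ≤ M) : ‖g.contLinear‖ ≤ M / r := by
  have hM : 0 ≤ M := (norm_nonneg _).trans (hg c (Metric.mem_closedBall_self hr.le))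
  refine ContinuousLinearMap.opNorm_le_of_unit_norm (by positivity) fun e he => ?_
  have hre : ‖r • e‖ = r := by rw [norm_smul, he, mul_one, Real.norm_of_nonneg hr.le]
  have hdiff : (2 * r) • g.contLinear e = g (c + r • e) - g (c - r • e) := by
    rw [← vsub_eq_sub (g _), ← g.contLinear_map_vsub, ← map_smul, vsub_eq_sub]
    congr 1
    module
  have hle : ‖(2 * r) • g.contLinear e‖ ≤ M + M := by
    rw [hdiff]
    exact norm_sub_le_of_le (hg _ (by simp [hre])) (hg _ (by simp [hre]))
  rw [norm_smul, Real.norm_of_nonneg (by positivity)] at hle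
  rw [le_div_iff₀ hr]
  linarith

lemma lipschitzWith_nnnorm_contLinear (g : E →ᴬ[ℝ] F) : LipschitzWith ‖g.contLinear‖₊ g :=
  LipschitzWith.of_dist_le_mul fun x y => by
    rw [dist_eq_norm, dist_eq_norm, ← vsub_eq_sub (g x), ← g.contLinear_map_vsub]
    exact g.contLinear.le_opNorm _

/-- The Taylor polynomial of degree one of `φ` at `x`, as an affine map. -/
def affineTaylor (φ : E → F) (x : E) : E →ᴬ[ℝ] F :=
  ContinuousAffineMap.const ℝ E (φ x - fderiv ℝ φ x x) + (fderiv ℝ φ x).toContinuousAffineMap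

lemma affineTaylor_apply (φ : E → F) (x y : E) :
    affineTaylor φ x y = φ x + fderiv ℝ φ x (y - x) := by
  change φ x - fderiv ℝ φ x x + fderiv ℝ φ x y = _
  rw [map_sub]
  abel

lemma contLinear_affineTaylor (φ : E → F) (x : E) :
    (affineTaylor φ x).contLinear = fderiv ℝ φ x := by
  simp [affineTaylor]

lemma norm_sub_affineTaylor_le {φ : E → F} (hφ : Differentiable ℝ φ) {K : ℝ≥0}
    (hK : LipschitzWith K (fderiv ℝ φ)) (x y : E) :
    ‖φ y - affineTaylor φ x y‖ ≤ K * ‖y - x‖ ^ 2 := by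
  rw [affineTaylor_apply, ← sub_sub, sq, ← mul_assoc]
  refine (convex_closedBall x ‖y - x‖).norm_image_sub_le_of_norm_fderiv_le' (fun z _ => hφ z)
    (fun z hz => ?_) (Metric.mem_closedBall_self (norm_nonneg _)) (mem_closedBall_iff_norm.2 le_rfl)
  rw [← dist_eq_norm]
  exact (hK.dist_le_mul z x).trans
    (mul_le_mul_of_nonneg_left (Metric.mem_closedBall.1 hz) K.coe_nonneg)

variable {φ : E → F} (hφ : Differentiable ℝ φ) {K : ℝ≥0} (hK : LipschitzWith K (fderiv ℝ φ))
  {s : Set E} (hs : Bornology.IsBounded s) {g : E →ᴬ[ℝ] F} (hg : EqOn g φ s) {x : E}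
  (hx : x ∈ convexHull ℝ s)
include hφ hK hs hg hx

lemma norm_affine_sub_affineTaylor_le {y : E} (hy : y ∈ convexHull ℝ s) :
    ‖(g - affineTaylor φ x) y‖ ≤ K * Metric.diam (convexHull ℝ s) ^ 2 := by
  refine norm_le_of_mem_convexHull (g - affineTaylor φ x).toAffineMap (fun v hv => ?_) hy
  change ‖g v - affineTaylor φ x v‖ ≤ _
  rw [hg hv]
  refine (norm_sub_affineTaylor_le hφ hK x v).trans ?_
  gcongr
  rw [← dist_eq_norm]
  exact Metric.dist_le_diam_of_mem (isBounded_convexHull.2 hs) (subset_convexHull ℝ s hv) hx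

lemma norm_affine_sub_le : ‖g x - φ x‖ ≤ K * Metric.diam (convexHull ℝ s) ^ 2 := by
  simpa [affineTaylor_apply] using norm_affine_sub_affineTaylor_le hφ hK hs hg hx hx

lemma norm_contLinear_sub_fderiv_le {c : E} {r : ℝ} (hr : 0 < r)
    (hc : Metric.closedBall c r ⊆ convexHull ℝ s) :
    ‖g.contLinear - fderiv ℝ φ x‖ ≤ K * Metric.diam (convexHull ℝ s) ^ 2 / r := by
  rw [← contLinear_affineTaylor φ x, ← ContinuousAffineMap.sub_contLinear]
  exact norm_contLinear_le_of_closedBall _ hr fun y hy =>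
    norm_affine_sub_affineTaylor_le hφ hK hs hg hx (hc hy)

end AffineApproximation

section Metric

lemma tendsto_infDist_of_mem_closure {X ι : Type*} [PseudoMetricSpace X] {l : Filter ι}
    {S : ι → Set X} {D : Set X} (hD : ∀ q ∈ D, Tendsto (fun i => Metric.infDist q (S i)) l (𝓝 0))
    {y : X} (hy : y ∈ closure D) : Tendsto (fun i => Metric.infDist y (S i)) l (𝓝 0) := by
  refine tendsto_order.2 ⟨fun a ha => Eventually.of_forall fun i =>
    ha.trans_le Metric.infDist_nonneg, fun η hη => ?_⟩
  obtain ⟨q, hq, hyq⟩ := Metric.mem_closure_iff.1 hy (η / 2) (half_pos hη)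
  filter_upwards [(hD q hq).eventually_lt_const (half_pos hη)] with i hi
  linarith [Metric.infDist_le_infDist_add_dist (s := S i) (x := y) (y := q)]

end Metric

section NodalInterpolation

variable {d : ℕ} {Ω : Set (Eucl d)}

namespace Mesh

/-- The condition of shape-regularity with constant `ρ` for a single mesh. -/
def IsShapeRegularWith (T : Mesh Ω) (ρ : ℝ) : Prop :=
  ∀ s ∈ T.elements, ∃ x : Eucl d,
    Metric.closedBall x (ρ * simplexDiam s) ⊆ convexHull ℝ (s : Set (Eucl d))

variable (T : Mesh Ω) (φ : Eucl d → ℝ)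

lemma exists_mem_convexHull {x : Eucl d} (hx : x ∈ closure Ω) :
    ∃ s : T.elements, x ∈ convexHull ℝ (s : Set (Eucl d)) := by
  rw [T.covers] at hx
  obtain ⟨s, hs, hxs⟩ := mem_iUnion₂.1 hx
  exact ⟨⟨s, hs⟩, hxs⟩

lemma convexHull_subset_closure (s : T.elements) :
    convexHull ℝ (s : Set (Eucl d)) ⊆ closure Ω := by
  rw [T.covers]
  exact subset_iUnion₂_of_subset s.1 s.2 subset_rfl

lemma simplexDiam_le_width (s : T.elements) : simplexDiam s.1 ≤ T.width :=
  le_csSup (T.elements.finite_toSet.image _).bddAbove (mem_image_of_mem _ s.2)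

lemma ae_exists_mem_interior (hΩ : IsOpen Ω) :
    ∀ᵐ x ∂(volume.restrict Ω), ∃ s : T.elements,
      x ∈ interior (convexHull ℝ (s : Set (Eucl d))) := by
  have hfrontier (s : T.elements) : ∀ᵐ x ∂(volume.restrict Ω),
      x ∉ frontier (convexHull ℝ (s : Set (Eucl d))) :=
    ae_restrict_of_ae <| measure_eq_zero_iff_ae_notMem.1 <|
      (convex_convexHull ℝ _).addHaar_frontier volume
  filter_upwards [eventually_countable_forall.2 hfrontier, ae_restrict_mem hΩ.measurableSet]
    with x hx hxΩ
  obtain ⟨s, hs⟩ := T.exists_mem_convexHull (subset_closure hxΩ)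
  exact ⟨s, by_contra fun h => hx s ⟨subset_closure hs, h⟩⟩

/-- The vertices of a simplex as an affine basis, whose coordinates are the barycentric ones. -/
def vertexBasis (s : T.elements) : AffineBasis s.1 ℝ (Eucl d) where
  toFun := (↑)
  ind' := T.affineIndependent s.1 s.2
  tot' := (T.affineIndependent s.1 s.2).affineSpan_eq_top_iff_card_eq_finrank_add_one.2
    (by simp [T.card_eq s.1 s.2])

/-- The affine function that agrees with `φ` at the vertices of the simplex `s`. -/
def nodalAffine (s : T.elements) : Eucl d →ᴬ[ℝ] ℝ where
  toAffineMap := (Fintype.linearCombination ℝ fun v : s.1 => φ v).toAffineMap.comp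
    (T.vertexBasis s).coords
  cont := AffineMap.continuous_of_finiteDimensional _

lemma nodalAffine_eqOn (s : T.elements) : EqOn (T.nodalAffine φ s) φ s.1 := by
  classical
  intro v hv
  have hcoord (i : s.1) : (T.vertexBasis s).coord i v = if i = ⟨v, hv⟩ then 1 else 0 :=
    (T.vertexBasis s).coord_apply i ⟨v, hv⟩
  change Fintype.linearCombination ℝ (fun v : s.1 => φ v) ((T.vertexBasis s).coords v) = φ v
  simp [Fintype.linearCombination_apply, AffineBasis.coords_apply, hcoord]

-- Conformity: two simplices meet in the convex hull of their common vertices.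
lemma nodalAffine_eq_nodalAffine {s t : T.elements} {x : Eucl d}
    (hs : x ∈ convexHull ℝ (s : Set (Eucl d))) (ht : x ∈ convexHull ℝ (t : Set (Eucl d))) :
    T.nodalAffine φ s x = T.nodalAffine φ t x := by
  refine sub_eq_zero.1 (norm_le_zero_iff.1 ?_)
  refine norm_le_of_mem_convexHull (T.nodalAffine φ s - T.nodalAffine φ t).toAffineMap
    (fun v hv => ?_) (T.conforming s.1 s.2 t.1 t.2 ⟨hs, ht⟩)
  change ‖T.nodalAffine φ s v - T.nodalAffine φ t v‖ ≤ 0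
  rw [T.nodalAffine_eqOn φ s hv.1, T.nodalAffine_eqOn φ t hv.2, sub_self, norm_zero]

open scoped Classical in
/-- The continuous piecewise affine nodal interpolant of `φ`, extended by zero outside of
`closure Ω`. -/
def interpolant (x : Eucl d) : ℝ :=
  if hx : ∃ s : T.elements, x ∈ convexHull ℝ (s : Set (Eucl d)) then
    T.nodalAffine φ hx.choose x else 0

lemma interpolant_eqOn (s : T.elements) :
    EqOn (T.interpolant φ) (T.nodalAffine φ s) (convexHull ℝ (s : Set (Eucl d))) := by
  intro x hx
  have hex : ∃ s : T.elements, x ∈ convexHull ℝ (s : Set (Eucl d)) := ⟨s, hx⟩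
  rw [interpolant, dif_pos hex]
  exact T.nodalAffine_eq_nodalAffine φ hex.choose_spec hx

lemma interpolant_of_notMem {x : Eucl d} (hx : x ∉ closure Ω) : T.interpolant φ x = 0 :=
  dif_neg fun ⟨s, hs⟩ => hx (T.convexHull_subset_closure s hs)

lemma hasFDerivAt_interpolant {s : T.elements} {x : Eucl d}
    (hx : x ∈ interior (convexHull ℝ (s : Set (Eucl d)))) :
    HasFDerivAt (T.interpolant φ) (T.nodalAffine φ s).contLinear x :=
  (T.nodalAffine φ s).hasFDerivAt.congr_of_eventuallyEq <|
    (T.interpolant_eqOn φ s).eventuallyEq_of_mem (mem_interior_iff_mem_nhds.1 hx)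

lemma tsupport_interpolant_subset :
    tsupport (T.interpolant φ) ⊆ Metric.cthickening T.width (tsupport φ) := by
  refine closure_minimal (fun x hx => ?_) Metric.isClosed_cthickening
  obtain ⟨s, hs⟩ := T.exists_mem_convexHull
    (not_imp_comm.1 (T.interpolant_of_notMem φ) hx)
  obtain ⟨v, hvs, hv⟩ : ∃ v ∈ s.1, φ v ≠ 0 := by
    by_contra! hzero
    refine hx ((T.interpolant_eqOn φ s hs).trans (norm_le_zero_iff.1 ?_))
    refine norm_le_of_mem_convexHull (T.nodalAffine φ s).toAffineMap (fun v hv => ?_) hs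
    exact (norm_eq_zero.2 ((T.nodalAffine_eqOn φ s hv).trans (hzero v hv))).le
  refine Metric.mem_cthickening_of_dist_le x v _ _ (subset_tsupport _ hv) ?_
  exact (Metric.dist_le_diam_of_mem (isBounded_convexHull.2 s.1.finite_toSet.isBounded) hs
    (subset_convexHull ℝ _ hvs)).trans (T.simplexDiam_le_width s)

lemma exists_lipschitzWith_interpolant (hΩ : IsOpen Ω) (hφ : tsupport (T.interpolant φ) ⊆ Ω) :
    ∃ K, LipschitzWith K (T.interpolant φ) := by
  let A : Option T.elements → Set (Eucl d) := fun o =>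
    o.elim (closure (closure Ω)ᶜ) fun s => convexHull ℝ (s : Set (Eucl d))
  have hA : ∀ o, IsClosed (A o)
    | none => isClosed_closure
    | some s => (s.1.finite_toSet.isCompact_convexHull (𝕜 := ℝ)).isClosed
  have hcov : ⋃ o, A o = univ := by
    refine iUnion_eq_univ_iff.2 fun x => ?_
    by_cases hx : x ∈ closure Ω
    · exact (T.exists_mem_convexHull hx).elim fun s hs => ⟨some s, hs⟩
    · exact ⟨none, subset_closure hx⟩
  have hzero : EqOn (T.interpolant φ) 0 (closure (closure Ω)ᶜ) := by
    intro x hx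
    by_contra hne
    obtain ⟨z, hzΩ, hz⟩ := mem_closure_iff.1 hx Ω hΩ (hφ (subset_tsupport _ hne))
    exact hz (subset_closure hzΩ)
  let K : ℝ≥0 := Finset.univ.sup fun s => ‖(T.nodalAffine φ s).contLinear‖₊
  refine ⟨K, lipschitzWith_of_finite_closed_cover hA hcov ?_⟩
  rintro (_ | s)
  · intro x hx y hy
    rw [hzero hx, hzero hy]
    exact (LipschitzWith.const' (0 : ℝ)).weaken zero_le _ _
  · intro x hx y hy
    rw [T.interpolant_eqOn φ s hx, T.interpolant_eqOn φ s hy]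
    exact (lipschitzWith_nnnorm_contLinear _).weaken
      (Finset.le_sup (f := fun s => ‖(T.nodalAffine φ s).contLinear‖₊) (Finset.mem_univ s)) _ _

lemma exists_mem_space_ae_eq_interpolant (hΩo : IsOpen Ω) (hΩ : Bornology.IsBounded Ω)
    (hφ : tsupport (T.interpolant φ) ⊆ Ω) :
    ∃ p ∈ T.space, p.fst =ᵐ[volume.restrict Ω] T.interpolant φ ∧
      p.snd =ᵐ[volume.restrict Ω] gradient (T.interpolant φ) := by
  obtain ⟨K, hK⟩ := T.exists_lipschitzWith_interpolant φ hΩo hφ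
  obtain ⟨p, hp, hfst, hsnd⟩ := exists_mem_H10_of_lipschitz hΩo hΩ hK hφ
  exact ⟨p, ⟨hp, fun s hs => ⟨(T.nodalAffine φ ⟨s, hs⟩).toAffineMap, hfst.mono fun x hx hxs =>
    hx.trans (T.interpolant_eqOn φ ⟨s, hs⟩ hxs)⟩⟩, hfst, hsnd⟩

end Mesh

end NodalInterpolation

section InterpolationError

variable {d : ℕ} {Ω : Set (Eucl d)}

lemma norm_sub_le_of_ae_bound {X F : Type*} [MeasurableSpace X] {μ : Measure X}
    [IsFiniteMeasure μ] [NormedAddCommGroup F] {f g : Lp F 2 μ} {M : ℝ} (hM : 0 ≤ M)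
    (hfg : ∀ᵐ x ∂μ, ‖f x - g x‖ ≤ M) : ‖f - g‖ ≤ √(μ.real univ) * M := by
  have hconst : (measureUnivNNReal μ : ℝ) ^ (2 : ℝ≥0∞).toReal⁻¹ = √(μ.real univ) := by
    rw [Real.sqrt_eq_rpow]
    simp [measureUnivNNReal, Measure.real, ENNReal.coe_toNNReal_eq_toReal]
  rw [← hconst]
  refine Lp.norm_le_of_ae_bound hM ?_
  filter_upwards [Lp.coeFn_sub f g, hfg] with x hx hle
  rwa [hx]

namespace Mesh

lemma simplexDiam_pos (hd : 1 ≤ d) (T : Mesh Ω) (s : T.elements) : 0 < simplexDiam s.1 := by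
  obtain ⟨v, hv, w, hw, hne⟩ := Finset.one_lt_card.1 (show 1 < s.1.card by
    rw [T.card_eq s.1 s.2]; omega)
  exact (dist_pos.2 hne).trans_le <|
    Metric.dist_le_diam_of_mem (isBounded_convexHull.2 s.1.finite_toSet.isBounded)
      (subset_convexHull ℝ _ hv) (subset_convexHull ℝ _ hw)

lemma width_nonneg (T : Mesh Ω) : 0 ≤ T.width :=
  Real.sSup_nonneg <| by
    rintro _ ⟨s, -, rfl⟩
    exact Metric.diam_nonneg

variable (T : Mesh Ω) {φ : Eucl d → ℝ} (hφ : Differentiable ℝ φ) {K : ℝ≥0}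
  (hK : LipschitzWith K (fderiv ℝ φ))
include hφ hK

lemma norm_interpolant_sub_le {s : T.elements} {x : Eucl d}
    (hx : x ∈ convexHull ℝ (s : Set (Eucl d))) :
    ‖T.interpolant φ x - φ x‖ ≤ K * T.width ^ 2 := by
  rw [T.interpolant_eqOn φ s hx]
  refine (norm_affine_sub_le hφ hK s.1.finite_toSet.isBounded (T.nodalAffine_eqOn φ s) hx).trans ?_
  have hdiam : Metric.diam (convexHull ℝ (s : Set (Eucl d))) ≤ T.width := T.simplexDiam_le_width s
  gcongr

lemma norm_gradient_interpolant_sub_le (hd : 1 ≤ d) {ρ : ℝ} (hρ : 0 < ρ)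
    (hT : T.IsShapeRegularWith ρ) {s : T.elements} {x : Eucl d}
    (hx : x ∈ interior (convexHull ℝ (s : Set (Eucl d)))) :
    ‖gradient (T.interpolant φ) x - gradient φ x‖ ≤ K * T.width / ρ := by
  obtain ⟨c, hc⟩ := hT s.1 s.2
  have hpos : 0 < simplexDiam s.1 := simplexDiam_pos hd T s
  have hgrad := norm_contLinear_sub_fderiv_le hφ hK s.1.finite_toSet.isBounded
    (T.nodalAffine_eqOn φ s) (interior_subset hx) (mul_pos hρ hpos) hc
  rw [gradient, gradient, ← map_sub, LinearIsometryEquiv.norm_map,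
    (T.hasFDerivAt_interpolant φ hx).fderiv]
  calc _ ≤ K * simplexDiam s.1 ^ 2 / (ρ * simplexDiam s.1) := hgrad
    _ = K * simplexDiam s.1 / ρ := by field_simp
    _ ≤ K * T.width / ρ := by
      gcongr
      exact T.simplexDiam_le_width s

lemma infDist_space_le (hd : 1 ≤ d) (hΩo : IsOpen Ω) (hΩ : Bornology.IsBounded Ω) {ρ : ℝ}
    (hρ : 0 < ρ) (hT : T.IsShapeRegularWith ρ) (hsupp : tsupport (T.interpolant φ) ⊆ Ω)
    {q : GradPair Ω} (hfst : q.fst =ᵐ[volume.restrict Ω] φ)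
    (hsnd : q.snd =ᵐ[volume.restrict Ω] gradient φ) :
    Metric.infDist q T.space ≤
      √(volume.real Ω) * (K * T.width ^ 2) + √(volume.real Ω) * (K * T.width / ρ) := by
  have : IsFiniteMeasure (volume.restrict Ω) := ⟨by simpa using hΩ.measure_lt_top⟩
  obtain ⟨p, hp, hpfst, hpsnd⟩ := T.exists_mem_space_ae_eq_interpolant φ hΩo hΩ hsupp
  have hw : 0 ≤ T.width := T.width_nonneg
  have hle_fst : ‖p.fst - q.fst‖ ≤ √(volume.real Ω) * (K * T.width ^ 2) := by
    rw [← measureReal_restrict_apply_univ]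
    refine norm_sub_le_of_ae_bound (by positivity) ?_
    filter_upwards [hpfst, hfst, T.ae_exists_mem_interior hΩo] with x hpx hqx ⟨s, hs⟩
    rw [hpx, hqx]
    exact T.norm_interpolant_sub_le hφ hK (interior_subset hs)
  have hle_snd : ‖p.snd - q.snd‖ ≤ √(volume.real Ω) * (K * T.width / ρ) := by
    rw [← measureReal_restrict_apply_univ]
    refine norm_sub_le_of_ae_bound (by positivity) ?_
    filter_upwards [hpsnd, hsnd, T.ae_exists_mem_interior hΩo] with x hpx hqx ⟨s, hs⟩
    rw [hpx, hqx]
    exact T.norm_gradient_interpolant_sub_le hφ hK hd hρ hT hs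
  calc Metric.infDist q T.space ≤ dist p q := dist_comm p q ▸ Metric.infDist_le_dist_of_mem hp
    _ ≤ ‖p.fst - q.fst‖ + ‖p.snd - q.snd‖ := by
      rw [dist_eq_norm, ← WithLp.sub_fst, ← WithLp.sub_snd, ← sq_le_sq₀ (by positivity)
        (by positivity), WithLp.prod_norm_sq_eq_of_L2, add_sq]
      exact add_le_add_left (le_add_of_nonneg_right (by positivity)) _
    _ ≤ _ := add_le_add hle_fst hle_snd

end Mesh

variable {ι : Type*} {l : Filter ι} {T : ι → Mesh Ω}

lemma tendsto_infDist_space_of_mem_testPairs (hd : 1 ≤ d) (hΩo : IsOpen Ω)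
    (hΩ : Bornology.IsBounded Ω) (hTs : ShapeRegular T)
    (hTw : Tendsto (fun i => (T i).width) l (𝓝 0)) {q : GradPair Ω} (hq : q ∈ testPairs Ω) :
    Tendsto (fun i => Metric.infDist q (T i).space) l (𝓝 0) := by
  obtain ⟨ρ, hρ, hT⟩ := hTs
  obtain ⟨φ, hsmooth, hcomp, hsupp, hfst, hsnd⟩ := hq
  obtain ⟨K, hK⟩ : ∃ K, LipschitzWith K (fderiv ℝ φ) :=
    (hsmooth.fderiv_right (m := ∞) (by simp)).lipschitzWith_of_hasCompactSupport
      (hcomp.fderiv ℝ) (by simp)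
  obtain ⟨r, hr, hrΩ⟩ := IsCompact.exists_cthickening_subset_open hcomp hΩo hsupp
  have hbound : Tendsto (fun w : ℝ => √(volume.real Ω) * (K * w ^ 2) +
      √(volume.real Ω) * (K * w / ρ)) (𝓝 0) (𝓝 0) :=
    Continuous.tendsto' (by fun_prop) 0 0 (by simp)
  refine squeeze_zero' (Eventually.of_forall fun i => Metric.infDist_nonneg) ?_
    (hbound.comp hTw)
  filter_upwards [hTw.eventually_lt_const hr] with i hi
  have hsuppi : tsupport ((T i).interpolant φ) ⊆ Ω :=
    ((T i).tsupport_interpolant_subset φ).trans ((Metric.cthickening_mono hi.le _).trans hrΩ)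
  exact (T i).infDist_space_le (hsmooth.differentiable (by simp)) hK hd hΩo hΩ hρ (hT i)
    hsuppi hfst hsnd

lemma tendsto_infDist_space (hd : 1 ≤ d) (hΩo : IsOpen Ω) (hΩ : Bornology.IsBounded Ω)
    (hTs : ShapeRegular T) (hTw : Tendsto (fun i => (T i).width) l (𝓝 0)) {y : GradPair Ω}
    (hy : y ∈ H10 Ω) : Tendsto (fun i => Metric.infDist y (T i).space) l (𝓝 0) :=
  tendsto_infDist_of_mem_closure
    (fun _ => tendsto_infDist_space_of_mem_testPairs hd hΩo hΩ hTs hTw) hy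

end InterpolationError

section PiecewiseAffine

variable {E : Type*} [NormedAddCommGroup E] [NormedSpace ℝ E] [FiniteDimensional ℝ E]
  [MeasurableSpace E] [BorelSpace E] (μ : Measure E) [IsFiniteMeasureOnCompacts μ]

lemma memLp_affine_restrict {s : Set E} (hs : IsCompact s) (g : E →ᵃ[ℝ] ℝ) :
    MemLp g 2 (μ.restrict s) := by
  have hg : Continuous g := g.continuous_of_finiteDimensional
  obtain ⟨M, hM⟩ := hs.exists_bound_of_continuousOn hg.continuousOn
  have : IsFiniteMeasure (μ.restrict s) := ⟨by simpa using hs.measure_lt_top⟩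
  exact MemLp.of_bound hg.aestronglyMeasurable M (ae_restrict_of_forall_mem hs.measurableSet hM)

/-- The affine functions as elements of `L²(s)` for a compact set `s`. -/
def affineToL2 {s : Set E} (hs : IsCompact s) : (E →ᵃ[ℝ] ℝ) →ₗ[ℝ] Lp ℝ 2 (μ.restrict s) where
  toFun g := (memLp_affine_restrict μ hs g).toLp g
  map_add' g k := MemLp.toLp_add (memLp_affine_restrict μ hs g) (memLp_affine_restrict μ hs k)
  map_smul' c g := MemLp.toLp_const_smul c (memLp_affine_restrict μ hs g)

variable {κ : Type*} {A : κ → Set E} (hA : ∀ i, IsCompact (A i))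

/-- The functions in `L²(μ)` that are almost everywhere affine on each of the sets `A i`. -/
def piecewiseAffine : Submodule ℝ (Lp ℝ 2 μ) :=
  ⨅ i, (LinearMap.range (affineToL2 μ (hA i))).comap
    (LpToLpRestrictCLM E ℝ ℝ μ 2 (A i)).toLinearMap

lemma mem_piecewiseAffine {f : Lp ℝ 2 μ} : f ∈ piecewiseAffine μ hA ↔
    ∀ i, ∃ g : E →ᵃ[ℝ] ℝ, ∀ᵐ x ∂μ, x ∈ A i → f x = g x := by
  simp only [piecewiseAffine, Submodule.mem_iInf, Submodule.mem_comap, LinearMap.mem_range]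
  refine forall_congr' fun i => exists_congr fun g => ?_
  have hf := LpToLpRestrictCLM_coeFn (μ := μ) (p := 2) ℝ (A i) f
  have hg : affineToL2 μ (hA i) g =ᵐ[μ.restrict (A i)] g :=
    (memLp_affine_restrict μ (hA i) g).coeFn_toLp
  rw [← ae_restrict_iff' (hA i).measurableSet, Lp.ext_iff]
  exact ⟨fun h => hf.symm.trans (h.symm.trans hg), fun h => hg.trans (hf.trans h).symm⟩

lemma isClosed_piecewiseAffine : IsClosed (piecewiseAffine μ hA : Set (Lp ℝ 2 μ)) := by
  rw [piecewiseAffine, Submodule.coe_iInf]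
  exact isClosed_iInter fun i =>
    (Submodule.closed_of_finiteDimensional (LinearMap.range (affineToL2 μ (hA i)))).preimage
      (LpToLpRestrictCLM E ℝ ℝ μ 2 (A i)).continuous

lemma finiteDimensional_piecewiseAffine [Finite κ] (hcov : ∀ᵐ x ∂μ, ∃ i, x ∈ A i) :
    FiniteDimensional ℝ (piecewiseAffine μ hA) := by
  let r (i : κ) : piecewiseAffine μ hA →ₗ[ℝ] LinearMap.range (affineToL2 μ (hA i)) :=
    ((LpToLpRestrictCLM E ℝ ℝ μ 2 (A i)).toLinearMap.comp
      (piecewiseAffine μ hA).subtype).codRestrict _ fun f => (Submodule.mem_iInf _).1 f.2 i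
  refine Module.Finite.of_injective (LinearMap.pi r) <|
    (injective_iff_map_eq_zero _).2 fun f hf => Subtype.ext (Lp.ext ?_)
  have hzero (i : κ) : ∀ᵐ x ∂μ, x ∈ A i → f.1 x = 0 := by
    rw [← ae_restrict_iff' (hA i).measurableSet]
    have hi : LpToLpRestrictCLM E ℝ ℝ μ 2 (A i) f = 0 := congrArg Subtype.val (congrFun hf i)
    have hfi := LpToLpRestrictCLM_coeFn (μ := μ) (p := 2) ℝ (A i) f.1
    rw [hi] at hfi
    exact hfi.symm.trans (Lp.coeFn_zero ℝ 2 _)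
  filter_upwards [eventually_countable_forall.2 hzero, hcov, Lp.coeFn_zero ℝ 2 μ]
    with x hx ⟨i, hi⟩ hx0
  exact (hx i hi).trans hx0.symm

end PiecewiseAffine

section FiniteElements

variable {d : ℕ} {Ω : Set (Eucl d)}

namespace Mesh

variable (T : Mesh Ω)

lemma isCompact_convexHull (s : T.elements) : IsCompact (convexHull ℝ (s : Set (Eucl d))) :=
  s.1.finite_toSet.isCompact_convexHull (𝕜 := ℝ)

lemma mem_space_iff {v : GradPair Ω} : v ∈ T.space ↔
    v ∈ H10 Ω ∧ v.fst ∈ piecewiseAffine (volume.restrict Ω) T.isCompact_convexHull := by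
  rw [mem_piecewiseAffine, Subtype.forall]
  rfl

lemma isClosed_space : IsClosed (T.space : Set (GradPair Ω)) := by
  have heq : (T.space : Set (GradPair Ω)) = (H10 Ω : Set (GradPair Ω)) ∩
      (fun v => v.fst) ⁻¹' (piecewiseAffine (volume.restrict Ω) T.isCompact_convexHull) :=
    ext fun _ => T.mem_space_iff
  rw [heq]
  exact isClosed_H10.inter ((isClosed_piecewiseAffine _ _).preimage (WithLp.continuous_fst 2 _ _))

lemma finiteDimensional_map_space (hΩ : IsOpen Ω) :
    FiniteDimensional ℝ (T.space.map (WithLp.fstL 2 ℝ (L2 Ω) (L2Vec Ω)).toLinearMap) := by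
  have hcov : ∀ᵐ x ∂(volume.restrict Ω), ∃ s : T.elements, x ∈ convexHull ℝ (s : Set (Eucl d)) :=
    ae_restrict_of_forall_mem hΩ.measurableSet fun _ hx =>
      T.exists_mem_convexHull (subset_closure hx)
  have := finiteDimensional_piecewiseAffine _ T.isCompact_convexHull hcov
  refine Submodule.finiteDimensional_of_le
    (S₂ := piecewiseAffine (volume.restrict Ω) T.isCompact_convexHull) ?_
  rintro _ ⟨v, hv, rfl⟩
  exact (T.mem_space_iff.1 hv).2

end Mesh

lemma isGalerkin_space (hd : 1 ≤ d) (hΩo : IsOpen Ω) (hΩ : Bornology.IsBounded Ω) {ι : Type*}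
    {l : Filter ι} {T : ι → Mesh Ω} (hTs : ShapeRegular T)
    (hTw : Tendsto (fun i => (T i).width) l (𝓝 0)) :
    IsGalerkin (fun i => (T i).space) (H10 Ω) l where
  le _ _ hv := hv.1
  isClosed i := (T i).isClosed_space
  finiteDimensional i := (T i).finiteDimensional_map_space hΩo
  tendsto_infDist _ := tendsto_infDist_space hd hΩo hΩ hTs hTw

end FiniteElements

end VIControl

end

theorem lemma4p2_general {d : ℕ} (hd : 1 ≤ d) {Ω : Set (Eucl d)} (hΩo : IsOpen Ω)
    (hΩb : Bornology.IsBounded Ω) {ν : ℝ} (hν : 0 < ν) {yd ud : L2 Ω} {ι : Type*} {l : Filter ι}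
    {T : ι → Mesh Ω} (hTs : ShapeRegular T) (hTw : Tendsto (fun i => (T i).width) l (𝓝 0))
    {ubar : L2 Ω} {ε δ : ℝ} (hε : 0 < ε) (hδ : 0 < δ)
    (hqg : QuadraticGrowth (reduced (H10 Ω) ν yd ud) ubar ε δ) :
    (∀ i, ∃ u : L2 Ω, SolvesLocalized (reduced (T i).space ν yd ud) ubar ε u) ∧
    ∃ u : ι → L2 Ω,
      (∀ i, IsLocalMin (reduced (T i).space ν yd ud) (u i)) ∧
      (∀ᶠ i in l, SolvesLocalized (reduced (T i).space ν yd ud) ubar ε (u i)) ∧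
      Tendsto u l (𝓝 ubar) := by
  have : IsFiniteMeasure (volume.restrict Ω) := ⟨by simpa using hΩb.measure_lt_top⟩
  obtain ⟨C, hP⟩ := exists_hasPoincare_H10 hd hΩb
  exact (isGalerkin_space hd hΩo hΩb hTs hTw).exists_isLocalMin_tendsto isClosed_H10 hP
    (compactlyEmbedded_H10 hΩo hΩb) hν hε hδ hqg

theorem lemma4p2 {d : ℕ} (hd1 : 1 ≤ d) (hd3 : d ≤ 3)
    -- a bounded domain; it is polyhedral by the existence of the meshes below
    (Ω : Set (Eucl d)) (hΩo : IsOpen Ω) (hΩc : IsConnected Ω) (hΩb : Bornology.IsBounded Ω)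
    (ν : ℝ) (hν : 0 < ν) (yd ud : L2 Ω) (hud : MemLp ud ⊤ (volume.restrict Ω))
    -- a shape-regular, quasi-uniform family of meshes whose widths tend to zero
    {ι : Type*} (l : Filter ι) (T : ι → Mesh Ω) (hTs : ShapeRegular T) (hTq : QuasiUniform T)
    (hTw : Tendsto (fun i => (T i).width) l (𝓝 0))
    (ubar : L2 Ω) (ε δ : ℝ) (hε : 0 < ε) (hδ : 0 < δ)
    (hqg : QuadraticGrowth (reduced (H10 Ω) ν yd ud) ubar ε δ) :
    -- every localized discrete problem has a global minimizer
    (∀ i, ∃ u : L2 Ω, SolvesLocalized (reduced (T i).space ν yd ud) ubar ε u) ∧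
    -- there are local solutions of the discrete problems that converge to `ubar` in `L²(Ω)` and
    -- are, for small mesh widths, global minimizers of the localized problems
    ∃ u : ι → L2 Ω,
      (∀ i, IsLocalMin (reduced (T i).space ν yd ud) (u i)) ∧
      (∀ᶠ i in l, SolvesLocalized (reduced (T i).space ν yd ud) ubar ε (u i)) ∧
      Tendsto u l (𝓝 ubar) :=
  lemma4p2_general hd1 hΩo hΩb hν hTs hTw hε hδ hqg
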